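/- Let $\mathbb H$ be a real separable Hilbert space with norm $|\cdot|$, and let $(U(t,s))_{t\ge s}$, $s,t\in\mathbb R$, be an evolution family of bounded linear operators on $\mathbb H$: $U(s,s)=I$, $U(t,r)U(r,s)=U(t,s)$ for $t\ge r\ge s$, and $(t,s)\mapsto U(t,s)x$ is continuous on $\{t\ge s\}$ for every $x\in\mathbb H$. Let $(\mu_{t,s})_{t\ge s}$ be Borel probability measures on $\mathbb H$ with $\mu_{t,s}=\mu_{t,r}*(\mu_{r,s}\circ U(t,r)^{-1})$ for all $t\ge r\ge s$, and suppose that every $\mu_{t,s}$ is infinitely divisible with characteristic function $\hat\mu_{t,s}(\xi)=e^{-\psi_{t,s}(\xi)}$, $$\psi_{t,s}(\xi)=-i\langle a_{t,s},\xi\rangle+\tfrac12\langle\xi,R_{t,s}\xi\rangle-\int_{\mathbb H}\Big(e^{i\langle\xi,x\rangle}-1-\frac{i\langle\xi,x\rangle}{1+|x|^2}\Big)\,m_{t,s}(dx),$$ where $a_{t,s}\in\mathbb H$, $R_{t,s}$ is a nonnegative symmetric trace class operator and $m_{t,s}$ is a Lévy measure, that is, $m_{t,s}(\{0\})=0$ and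 $\int(1\wedge|x|^2)\,dm_{t,s}<\infty$. For bounded Borel measurable $f:\mathbb H\to\mathbb R$ put $p_{s,t}f(x)=\int_{\mathbb H}f(U(t,s)x+y)\,\mu_{t,s}(dy)$. Let $\Gamma_{t,s}=R_{t,s}^{-1/2}U(t,s)$, where $R_{t,s}^{-1/2}$ is the pseudo-inverse of $R_{t,s}^{1/2}$ (it maps $y\in R_{t,s}^{1/2}\mathbb H$ to its preimage of minimal norm); put $|\Gamma_{t,s}x|=\infty$ if $U(t,s)x\notin R_{t,s}^{1/2}\mathbb H$, and $\|\Gamma_{t,s}\|=\sup_{|x|\le1}|\Gamma_{t,s}x|\in[0,\infty]$. Fix $t\ge s$ and consider the following statements. 1. $U(t,s)\mathbb H\subset R_{t,s}^{1/2}\mathbb H$ (null-controllability condition). 2. $\|\Gamma_{t,s}\|<\infty$, and for every $\alpha>1$ and every bounded Borel measurable $f\ge0$, $$(p_{s,t}f(x))^\alpha\le\exp\Big[\frac{\alpha(\|\Gamma_{t,s}\|\,|x-y|)^2}{2(\alpha-1)}\Big]\,p_{s,t}f^\alpha(y),\qquad x,y\in\mathbb H. \tag{H}$$ 3. $\|\Gamma_{t,s}\|<\infty$,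 and there is an $\alpha>1$ such that (H) holds for every bounded Borel measurable $f\ge0$. 4. $\|\Gamma_{t,s}\|<\infty$, and for every bounded Borel measurable $f>1$, $$p_{s,t}\log f(x)\le\log p_{s,t}f(y)+\frac{\|\Gamma_{t,s}\|^2}{2}|x-y|^2,\qquad x,y\in\mathbb H.$$ 5. $p_{s,t}$ is strong Feller: it maps bounded Borel measurable functions to bounded continuous functions. Then (1)$\Rightarrow$(2)$\Rightarrow$(3)$\Rightarrow$(4)$\Rightarrow$(5). If moreover $m_{t,s}=0$ (the Gaussian case), then (1)-(5) are equivalent. -/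

import Mathlib

open MeasureTheory Set
open scoped ENNReal RealInnerProductSpace

namespace MehlerSemigroup

universe u

variable {H : Type u} [NormedAddCommGroup H] [InnerProductSpace ℝ H]

/-- `(U (t, s))` for `t ≥ s` is an evolution family of bounded operators on `H`; the values
`U t s` with `t < s` play no role. -/
structure IsEvolutionFamily (U : ℝ → ℝ → H →L[ℝ] H) : Prop where
  self_eq_id : ∀ s : ℝ, U s s = ContinuousLinearMap.id ℝ H
  comp_eq : ∀ s r t : ℝ, s ≤ r → r ≤ t → (U t r).comp (U r s) = U t s
  strongly_continuous : ∀ x : H,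
    ContinuousOn (fun q : ℝ × ℝ => U q.1 q.2 x) {q : ℝ × ℝ | q.2 ≤ q.1}

/-- Nonnegative symmetric trace class operators: positive operators (`IsPositive` includes
symmetry) whose diagonal is summable in every orthonormal basis. -/
structure IsPositiveTraceClass (R : H →L[ℝ] H) : Prop where
  isPositive : R.IsPositive
  summable_diag : ∀ (w : Set H) (b : HilbertBasis w ℝ H), Summable fun i => ⟪b i, R (b i)⟫

open Classical in
/-- The square root `R ^ (1/2)` of a positive operator `R` on a Hilbert space: the (unique)
positive operator `S` with `S ∘ S = R`. (Junk value `0` if `R` is not positive.) -/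
noncomputable def opSqrt (R : H →L[ℝ] H) : H →L[ℝ] H :=
  if h : ∃ S : H →L[ℝ] H, S.IsPositive ∧ S.comp S = R then h.choose else 0

open Classical in
/-- The pseudo-inverse of `S`: for `y` in the range of `S` the value is the preimage
of `y` of minimal norm, i.e. the unique preimage that is orthogonal to the kernel of `S`.
(Junk value `0` if `y` is not in the range.) -/
noncomputable def pseudoInv (S : H →L[ℝ] H) (y : H) : H :=
  if h : ∃ z : H, z ∈ (LinearMap.ker S.toLinearMap)ᗮ ∧ S z = y then h.choose else 0

open Classical in
/-- The extended norm `|Γ x|` for `Γ = R ^ (-1/2) V`, with the convention `|Γ x| = ∞` when `V x`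
is not in the range of `R ^ (1/2)`. -/
noncomputable def gammaNormAt (R V : H →L[ℝ] H) (x : H) : ℝ≥0∞ :=
  if V x ∈ range (opSqrt R) then ‖pseudoInv (opSqrt R) (V x)‖ₑ else ∞

/-- The (possibly infinite) operator norm `‖Γ‖ = sup {|Γ x| : |x| ≤ 1}` of
`Γ = R ^ (-1/2) V`. -/
noncomputable def gammaNorm (R V : H →L[ℝ] H) : ℝ≥0∞ :=
  ⨆ x : H, ⨆ _ : ‖x‖ ≤ 1, gammaNormAt R V x

variable [MeasurableSpace H]

/-- Lévy measures on `H`. -/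
structure IsLevyMeasure (m : Measure H) : Prop where
  zero_singleton : m {0} = 0
  lintegral_lt_top : ∫⁻ x, ENNReal.ofReal (min 1 (‖x‖ ^ 2)) ∂m < ∞

/-- The Lévy-Khintchine exponent
`ψ ξ = - i ⟨a, ξ⟩ + 1/2 ⟨ξ, R ξ⟩ - ∫ (exp (i ⟨ξ, x⟩) - 1 - i ⟨ξ, x⟩ / (1 + |x|²)) m(dx)`. -/
noncomputable def levyExponent (a : H) (R : H →L[ℝ] H) (m : Measure H) (ξ : H) : ℂ :=
  -Complex.I * (⟪a, ξ⟫ : ℂ) + (1 / 2 : ℂ) * (⟪ξ, R ξ⟫ : ℂ)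
    - ∫ x, (Complex.exp (Complex.I * (⟪ξ, x⟫ : ℂ)) - 1
        - Complex.I * (⟪ξ, x⟫ : ℂ) / (1 + (‖x‖ : ℂ) ^ 2)) ∂m

/-- `μ = D[a, R, m]`: the probability measure `μ` is the infinitely divisible law with
characteristic function `exp (-ψ)`, where `R` is a nonnegative symmetric trace class operator
and `m` a Lévy measure. -/
structure HasLevyTriplet (μ : Measure H) (a : H) (R : H →L[ℝ] H) (m : Measure H) : Prop where
  isProbabilityMeasure : IsProbabilityMeasure μ
  isPositiveTraceClass : IsPositiveTraceClass R
  isLevyMeasure : IsLevyMeasure m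
  charFun_eq : ∀ ξ : H, charFun μ ξ = Complex.exp (-levyExponent a R m ξ)

/-- The skew convolution equation `μ (t, s) = μ (t, r) * (μ (r, s) ∘ U (t, r)⁻¹)`. -/
def SkewConvolution (U : ℝ → ℝ → H →L[ℝ] H) (μ : ℝ → ℝ → Measure H) : Prop :=
  ∀ s r t : ℝ, s ≤ r → r ≤ t → μ t s = μ t r ∗ (μ r s).map (U t r)

/-- The operator `p (s, t) f x = ∫ f (U (t, s) x + y) μ (t, s) (dy)`. -/
noncomputable def mehlerOp (U : ℝ → ℝ → H →L[ℝ] H) (μ : ℝ → ℝ → Measure H) (s t : ℝ)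
    (f : H → ℝ) (x : H) : ℝ :=
  ∫ y, f (U t s x + y) ∂(μ t s)

/-- Bounded Borel measurable functions. -/
def IsBoundedMeasurable (f : H → ℝ) : Prop :=
  Measurable f ∧ ∃ C : ℝ, ∀ x, |f x| ≤ C

/-- The null-controllability condition `V H ⊆ R ^ (1/2) H`. -/
def NullControllability (R V : H →L[ℝ] H) : Prop :=
  range V ⊆ range (opSqrt R)

/-- The Harnack inequality with exponent `α` and constant `C` for the operator `P`, for all
nonnegative bounded measurable functions. -/
def HarnackInequality (P : (H → ℝ) → H → ℝ) (C α : ℝ) : Prop :=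
  ∀ f : H → ℝ, IsBoundedMeasurable f → (∀ x, 0 ≤ f x) → ∀ x y : H,
    (P f x) ^ α ≤ Real.exp (α * (C * ‖x - y‖) ^ 2 / (2 * (α - 1))) * P (fun z => f z ^ α) y

/-- The log-Harnack inequality with constant `C` for the operator `P`, for all bounded
measurable functions `f > 1`. -/
def LogHarnackInequality (P : (H → ℝ) → H → ℝ) (C : ℝ) : Prop :=
  ∀ f : H → ℝ, IsBoundedMeasurable f → (∀ x, 1 < f x) → ∀ x y : H,
    P (fun z => Real.log (f z)) x ≤ Real.log (P f y) + C ^ 2 / 2 * ‖x - y‖ ^ 2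

/-- The operator `Γ = R ^ (-1/2) V` is bounded, and the Harnack inequality with constant `‖Γ‖`
holds for `P` with every exponent `α > 1`. -/
def HarnackForAll (R V : H →L[ℝ] H) (P : (H → ℝ) → H → ℝ) : Prop :=
  gammaNorm R V < ∞ ∧ ∀ α : ℝ, 1 < α → HarnackInequality P (gammaNorm R V).toReal α

/-- The operator `Γ = R ^ (-1/2) V` is bounded, and the Harnack inequality with constant `‖Γ‖`
holds for `P` with some exponent `α > 1`. -/
def HarnackForSome (R V : H →L[ℝ] H) (P : (H → ℝ) → H → ℝ) : Prop :=
  gammaNorm R V < ∞ ∧ ∃ α : ℝ, 1 < α ∧ HarnackInequality P (gammaNorm R V).toReal α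

/-- The operator `Γ = R ^ (-1/2) V` is bounded, and the log-Harnack inequality with constant
`‖Γ‖` holds for `P`. -/
def LogHarnack (R V : H →L[ℝ] H) (P : (H → ℝ) → H → ℝ) : Prop :=
  gammaNorm R V < ∞ ∧ LogHarnackInequality P (gammaNorm R V).toReal

/-- Strong Feller property: bounded measurable functions are mapped to bounded continuous
functions. -/
def StrongFeller (P : (H → ℝ) → H → ℝ) : Prop :=
  ∀ f : H → ℝ, IsBoundedMeasurable f → Continuous (P f) ∧ ∃ C : ℝ, ∀ x, |P f x| ≤ C

end MehlerSemigroup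

set_option linter.unusedSectionVars false

namespace MehlerSemigroup


/-! ### Square roots of positive operators, pseudo-inverses and the operator `Γ`. -/

section Operators

variable {H : Type*} [NormedAddCommGroup H] [InnerProductSpace ℝ H]

/-! Write `S = R ^ (1/2)`. Under null-controllability the closed graph theorem makes `Γ` bounded,
and `V x = V y + S k` with `k = Γ (x - y)`. The Harnack inequality therefore reduces to a bound for
translates of one law `D[a, R, m]` along the range of `S` (`integral_shift_rpow_le`): shifting by `S
k` costs the factor `exp (p |k|² / (2 (p - 1)))` between `(∫ f) ^ p` and `∫ f ^ p`.

For this only one Gaussian direction matters. With `e = k / |k|`, the law should be that of `Z • S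
e` plus an independent remainder, where `Z` is a standard real Gaussian. Shifting `Z` by `|k|` has
the Cameron-Martin density, whose `L^q` norm is explicit, and Hölder's inequality gives the bound
whatever the remainder is (`lintegral_shift_gaussian_conv_le`). The splitting is realised only
approximately: after projection to a finite-dimensional space the remaining Gaussian factor exists,
the jump part is truncated near `0` to a compound Poisson law, and convergence of characteristic
functions yields weak convergence (`exists_tendsto_gaussian_conv`). As the constant depends on `|k|`
and `p` alone, the bound survives the removal of the truncation, then of the projection, and finally
extends from continuous to measurable `f`.

The log-Harnack inequality is the limit `α → ∞` of the Harnack inequality for `f ^ (1/α)`. Applied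
to small perturbations of the constant `1`, it shows that `P f` is Lipschitz, which is more than
strong Feller.

In the Gaussian case, if `V x` is not in the range of `S`, there is a set `A` of full measure
disjoint from all its translates by nonzero multiples of `V x`. Then `P 1_A (c x)` equals `1` at `c
= 0` and `0` elsewhere, which contradicts strong Feller. -/

theorem norm_one_sub_le_one {A : H →L[ℝ] H} (hA : A.IsPositive) (hA1 : ‖A‖ ≤ 1) :
    ‖1 - A‖ ≤ 1 := by
  have hsym : (1 - A).IsSymmetric := by
    intro x y
    have := hA.isSymmetric x y
    simp only [ContinuousLinearMap.coe_coe] at this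
    simp [inner_sub_left, inner_sub_right, this]
  rw [ContinuousLinearMap.norm_eq_iSup_rayleighQuotient _ hsym]
  refine ciSup_le fun x => ?_
  rcases eq_or_ne x 0 with rfl | hx
  · simp [ContinuousLinearMap.rayleighQuotient]
  have hx' : 0 < ‖x‖ ^ 2 := by positivity
  have h0 : 0 ≤ ⟪A x, x⟫ := hA.inner_nonneg_left x
  have h1 : ⟪A x, x⟫ ≤ ‖x‖ ^ 2 := by
    calc ⟪A x, x⟫ ≤ ‖A x‖ * ‖x‖ := real_inner_le_norm _ _
      _ ≤ (1 * ‖x‖) * ‖x‖ := by gcongr; exact A.le_of_opNorm_le hA1 x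
      _ = ‖x‖ ^ 2 := by ring
  have h2 : (1 - A).reApplyInnerSelf x = ‖x‖ ^ 2 - ⟪A x, x⟫ := by
    simp [ContinuousLinearMap.reApplyInnerSelf_apply, inner_sub_left]
  rw [ContinuousLinearMap.rayleighQuotient, h2, abs_le]
  constructor
  · exact (by norm_num : (-1 : ℝ) ≤ 0).trans (div_nonneg (by linarith) hx'.le)
  · rw [div_le_one hx']; linarith

/-- The iteration `Y ↦ (B + Y²) / 2`, which converges to `1 - (1 - B) ^ (1/2)`. -/
noncomputable def sqrtIter {𝔸 : Type*} [Ring 𝔸] [Algebra ℝ 𝔸] (b : 𝔸) : ℕ → 𝔸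
  | 0 => 0
  | n + 1 => (1 / 2 : ℝ) • (b + sqrtIter b n * sqrtIter b n)

/-- The scalar iteration with `b = 1` is the majorant for every `b` of norm at most `1`. Being
increasing and bounded, it has summable increments. -/
theorem sqrtIter_one_bounds (n : ℕ) :
    0 ≤ sqrtIter (1 : ℝ) n ∧ sqrtIter (1 : ℝ) n ≤ 1 ∧
      sqrtIter (1 : ℝ) n ≤ sqrtIter (1 : ℝ) (n + 1) := by
  induction n with
  | zero => simp [sqrtIter]
  | succ n ih =>
    obtain ⟨h0, h1, h2⟩ := ih
    refine ⟨h0.trans h2, ?_, ?_⟩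
    · simp only [sqrtIter, smul_eq_mul]; nlinarith
    · rw [sqrtIter, sqrtIter.eq_2 _ (n + 1), smul_eq_mul, smul_eq_mul]; nlinarith

theorem norm_sqrtIter_le {𝔸 : Type*} [NormedRing 𝔸] [NormedAlgebra ℝ 𝔸] {b : 𝔸} (hb : ‖b‖ ≤ 1)
    (n : ℕ) : ‖sqrtIter b n‖ ≤ sqrtIter (1 : ℝ) n := by
  induction n with
  | zero => simp [sqrtIter]
  | succ n ih =>
    rw [sqrtIter, sqrtIter, norm_smul, smul_eq_mul, Real.norm_of_nonneg (by norm_num)]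
    gcongr
    refine (norm_add_le _ _).trans (add_le_add hb ((norm_mul_le _ _).trans ?_))
    exact mul_le_mul ih ih (norm_nonneg _) (sqrtIter_one_bounds n).1

theorem norm_sqrtIter_succ_sub_le {𝔸 : Type*} [NormedRing 𝔸] [NormedAlgebra ℝ 𝔸] {b : 𝔸}
    (hb : ‖b‖ ≤ 1) (n : ℕ) :
    ‖sqrtIter b (n + 1) - sqrtIter b n‖ ≤ sqrtIter (1 : ℝ) (n + 1) - sqrtIter (1 : ℝ) n := by
  induction n with
  | zero => simpa [sqrtIter, norm_smul] using hb
  | succ n ih =>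
    -- The factorization `X² - Y² = X (X - Y) + (X - Y) Y` needs no commutativity and has the same
    -- form for the scalar majorant.
    have e : sqrtIter b (n + 2) - sqrtIter b (n + 1) = (1 / 2 : ℝ) •
        (sqrtIter b (n + 1) * (sqrtIter b (n + 1) - sqrtIter b n)
          + (sqrtIter b (n + 1) - sqrtIter b n) * sqrtIter b n) := by
      have h1 := sqrtIter.eq_2 b (n + 1)
      have h2 := sqrtIter.eq_2 b n
      calc sqrtIter b (n + 2) - sqrtIter b (n + 1)
          = (1 / 2 : ℝ) • (b + sqrtIter b (n + 1) * sqrtIter b (n + 1))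
            - (1 / 2 : ℝ) • (b + sqrtIter b n * sqrtIter b n) := congrArg₂ _ h1 h2
        _ = _ := by
          rw [← smul_sub]
          congr 1
          noncomm_ring
    have e1 : sqrtIter (1 : ℝ) (n + 2) - sqrtIter (1 : ℝ) (n + 1) = (1 / 2 : ℝ) *
        (sqrtIter (1 : ℝ) (n + 1) * (sqrtIter (1 : ℝ) (n + 1) - sqrtIter (1 : ℝ) n)
          + (sqrtIter (1 : ℝ) (n + 1) - sqrtIter (1 : ℝ) n) * sqrtIter (1 : ℝ) n) := by
      rw [sqrtIter.eq_2 1 (n + 1), smul_eq_mul]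
      nth_rw 3 [sqrtIter.eq_2 1 n]
      rw [smul_eq_mul]
      ring
    rw [e, e1, norm_smul, Real.norm_of_nonneg (by norm_num)]
    obtain ⟨h0, -, h2⟩ := sqrtIter_one_bounds n
    gcongr
    refine (norm_add_le _ _).trans (add_le_add ?_ ?_)
    · refine (norm_mul_le _ _).trans ?_
      gcongr
      · exact h0.trans h2
      · exact norm_sqrtIter_le hb _
    · refine (norm_mul_le _ _).trans ?_
      gcongr
      · exact norm_sqrtIter_le hb _

theorem cauchySeq_sqrtIter {𝔸 : Type*} [NormedRing 𝔸] [NormedAlgebra ℝ 𝔸] {b : 𝔸}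
    (hb : ‖b‖ ≤ 1) : CauchySeq (sqrtIter b) := by
  refine cauchySeq_of_dist_le_of_summable
    (fun n => sqrtIter (1 : ℝ) (n + 1) - sqrtIter (1 : ℝ) n) (fun n => ?_) ?_
  · rw [dist_comm, dist_eq_norm]
    exact norm_sqrtIter_succ_sub_le hb n
  · refine summable_of_sum_range_le (c := 1)
      (fun n => sub_nonneg.2 (sqrtIter_one_bounds n).2.2) (fun n => ?_)
    rw [Finset.sum_range_sub]
    simpa [sqrtIter] using (sqrtIter_one_bounds n).2.1

/-- The convention `|Γ x| = ∞` off the range makes finiteness of the supremum a range condition on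
the unit ball; homogeneity extends it to all `x`. -/
theorem nullControllability_of_gammaNorm_lt_top {R V : H →L[ℝ] H} (h : gammaNorm R V < ∞) :
    NullControllability R V := by
  rintro _ ⟨x, rfl⟩
  rcases eq_or_ne x 0 with rfl | hx
  · exact ⟨0, by simp⟩
  have hx' : ‖x‖ ≠ 0 := norm_ne_zero_iff.2 hx
  have h1 : gammaNormAt R V (‖x‖⁻¹ • x) < ∞ := lt_of_le_of_lt
    (le_iSup₂ (f := fun (x : H) (_ : ‖x‖ ≤ 1) => gammaNormAt R V x) (‖x‖⁻¹ • x)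
      (by rw [norm_smul, norm_inv, norm_norm, inv_mul_cancel₀ hx'])) h
  have h2 : V (‖x‖⁻¹ • x) ∈ range (opSqrt R) := by
    by_contra hn
    rw [gammaNormAt, if_neg hn] at h1
    exact lt_irrefl _ h1
  obtain ⟨z, hz⟩ := h2
  refine ⟨‖x‖ • z, ?_⟩
  rw [map_smul, hz, map_smul, smul_smul, mul_inv_cancel₀ hx', one_smul]

variable [CompleteSpace H]

/-- With `B = 1 - A`, the limit `Y` of the iteration satisfies `2 Y = B + Y²`, so `(1 - Y)² = 1 - B
= A`; positivity of `1 - Y` follows from `‖Y‖ ≤ 1`. -/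
theorem exists_isPositive_comp_self_of_norm_le_one {A : H →L[ℝ] H} (hA : A.IsPositive)
    (hA1 : ‖A‖ ≤ 1) : ∃ S : H →L[ℝ] H, S.IsPositive ∧ S.comp S = A := by
  have hB := norm_one_sub_le_one hA hA1
  have hBs : IsSelfAdjoint (1 - A) := (IsSelfAdjoint.one _).sub hA.isSelfAdjoint
  set B := 1 - A with hBdef
  obtain ⟨Y, hY⟩ := cauchySeq_tendsto_of_complete (cauchySeq_sqrtIter hB)
  have hYeq : Y = (1 / 2 : ℝ) • (B + Y * Y) := by
    refine tendsto_nhds_unique (hY.comp (Filter.tendsto_add_atTop_nat 1)) ?_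
    exact ((tendsto_const_nhds.add (hY.mul hY)).const_smul (1 / 2 : ℝ))
  have hYs : IsSelfAdjoint Y := by
    have hn : ∀ n, star (sqrtIter B n) = sqrtIter B n := by
      intro n
      induction n with
      | zero => simp [sqrtIter]
      | succ n ih => simp [sqrtIter, ih, hBs.star_eq]
    have h2 := (continuous_star.tendsto Y).comp hY
    exact tendsto_nhds_unique (h2.congr fun n => hn n) hY
  have hY1 : ‖Y‖ ≤ 1 := le_of_tendsto hY.norm <| Filter.Eventually.of_forall fun n =>
    (norm_sqrtIter_le hB n).trans (sqrtIter_one_bounds n).2.1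
  refine ⟨1 - Y, ?_, ?_⟩
  · rw [ContinuousLinearMap.isPositive_def']
    refine ⟨(IsSelfAdjoint.one _).sub hYs, fun x => ?_⟩
    have h1 : ⟪Y x, x⟫ ≤ ‖x‖ ^ 2 := by
      calc ⟪Y x, x⟫ ≤ ‖Y x‖ * ‖x‖ := real_inner_le_norm _ _
        _ ≤ (1 * ‖x‖) * ‖x‖ := by gcongr; exact Y.le_of_opNorm_le hY1 x
        _ = ‖x‖ ^ 2 := by ring
    simp only [ContinuousLinearMap.reApplyInnerSelf_apply, inner_sub_left,
      sub_apply, one_apply_eq_self, RCLike.re_to_real,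
      real_inner_self_eq_norm_sq]
    linarith
  · change (1 - Y) * (1 - Y) = A
    have h2 : Y + Y = B + Y * Y := by
      nth_rw 1 2 [hYeq]
      rw [← two_smul ℝ ((1 / 2 : ℝ) • _), smul_smul]
      norm_num
    calc (1 - Y) * (1 - Y) = 1 - (Y + Y) + Y * Y := by noncomm_ring
      _ = A := by rw [h2, hBdef]; abel

theorem exists_isPositive_comp_self {R : H →L[ℝ] H} (hR : R.IsPositive) :
    ∃ S : H →L[ℝ] H, S.IsPositive ∧ S.comp S = R := by
  rcases eq_or_ne R 0 with rfl | hR0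
  · exact ⟨0, ContinuousLinearMap.isPositive_zero, by simp⟩
  have hpos : 0 < ‖R‖ := norm_pos_iff.2 hR0
  obtain ⟨S, hS, hSS⟩ := exists_isPositive_comp_self_of_norm_le_one
    (hR.smul_of_nonneg (c := ‖R‖⁻¹) (by positivity)) (by
      rw [norm_smul, norm_inv, norm_norm, inv_mul_cancel₀ hpos.ne'])
  refine ⟨√‖R‖ • S, hS.smul_of_nonneg (Real.sqrt_nonneg _), ?_⟩
  rw [ContinuousLinearMap.smul_comp, ContinuousLinearMap.comp_smul, hSS, smul_smul, smul_smul,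
    Real.mul_self_sqrt hpos.le, mul_inv_cancel₀ hpos.ne', one_smul]

theorem opSqrt_spec {R : H →L[ℝ] H} (hR : R.IsPositive) :
    (opSqrt R).IsPositive ∧ (opSqrt R).comp (opSqrt R) = R := by
  have h := exists_isPositive_comp_self hR
  rw [opSqrt, dif_pos h]
  exact h.choose_spec

/-- The bound lets `⟪h, ·⟫` factor through `S` as a bounded functional on the range of `S`. Extend
it by Hahn-Banach and represent it by a vector `g`; self-adjointness gives `S g = h`. -/
theorem mem_range_of_abs_inner_le {S : H →L[ℝ] H} (hS : IsSelfAdjoint S) {h : H} {C : ℝ}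
    (hC : ∀ ξ, |⟪h, ξ⟫| ≤ C * ‖S ξ‖) : h ∈ range S := by
  have hker : LinearMap.ker S.toLinearMap ≤ LinearMap.ker (innerₗ H h) := by
    intro ξ hξ
    have hξ' : S ξ = 0 := hξ
    have := hC ξ
    rw [hξ', norm_zero, mul_zero, abs_nonpos_iff] at this
    simpa using this
  let φ : LinearMap.range S.toLinearMap →ₗ[ℝ] ℝ :=
    ((LinearMap.ker S.toLinearMap).liftQ (innerₗ H h) hker).comp
      S.toLinearMap.quotKerEquivRange.symm.toLinearMap
  have hφ : ∀ ξ (hξ : S ξ ∈ LinearMap.range S.toLinearMap), φ ⟨S ξ, hξ⟩ = ⟪h, ξ⟫ := by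
    intro ξ hξ
    have := S.toLinearMap.quotKerEquivRange_symm_apply_image ξ hξ
    simp only [ContinuousLinearMap.coe_coe] at this
    simp [φ, this]
  let ψ : StrongDual ℝ (LinearMap.range S.toLinearMap) := φ.mkContinuous C (by
    rintro ⟨_, ξ, rfl⟩
    have := hφ ξ ⟨ξ, rfl⟩
    simp only [ContinuousLinearMap.coe_coe] at this ⊢
    rw [this]
    exact hC ξ)
  obtain ⟨g, hg, -⟩ := exists_extension_norm_eq _ ψ
  refine ⟨(InnerProductSpace.toDual ℝ H).symm g, ?_⟩
  refine ext_inner_right ℝ fun ξ => ?_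
  have h1 : ⟪S ((InnerProductSpace.toDual ℝ H).symm g), ξ⟫
      = ⟪(InnerProductSpace.toDual ℝ H).symm g, S ξ⟫ := hS.isSymmetric _ _
  rw [h1, InnerProductSpace.toDual_symm_apply]
  have h2 := hg ⟨S ξ, ξ, rfl⟩
  rw [h2]
  exact hφ ξ ⟨ξ, rfl⟩

theorem pseudoInv_spec (S : H →L[ℝ] H) {y : H} (hy : y ∈ range S) :
    pseudoInv S y ∈ (LinearMap.ker S.toLinearMap)ᗮ ∧ S (pseudoInv S y) = y := by
  have h : ∃ z : H, z ∈ (LinearMap.ker S.toLinearMap)ᗮ ∧ S z = y := by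
    obtain ⟨w, rfl⟩ := hy
    have hc : IsClosed ((LinearMap.ker S.toLinearMap : Submodule ℝ H) : Set H) :=
      ContinuousLinearMap.isClosed_ker S
    have : CompleteSpace (LinearMap.ker S.toLinearMap) := hc.completeSpace_coe
    obtain ⟨u, hu, v, hv, huv⟩ :=
      (LinearMap.ker S.toLinearMap).exists_add_mem_mem_orthogonal w
    refine ⟨v, hv, ?_⟩
    have hu' : S u = 0 := hu
    rw [huv, map_add, hu', zero_add]
  rw [pseudoInv, dif_pos h]
  exact h.choose_spec

theorem eq_pseudoInv (S : H →L[ℝ] H) {z : H} (hz : z ∈ (LinearMap.ker S.toLinearMap)ᗮ) :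
    pseudoInv S (S z) = z := by
  obtain ⟨h1, h2⟩ := pseudoInv_spec S (mem_range_self z)
  have h3 : pseudoInv S (S z) - z ∈ LinearMap.ker S.toLinearMap := by
    simp [h2]
  exact sub_eq_zero.1 (Submodule.disjoint_def.1 (Submodule.orthogonal_disjoint _) _ h3
    (Submodule.sub_mem _ h1 hz))

/-- The operator `Γ = R ^ (-1/2) V` under the null-controllability condition. -/
noncomputable def gammaOp {R V : H →L[ℝ] H} (h : NullControllability R V) : H →L[ℝ] H :=
  ContinuousLinearMap.ofSeqClosedGraph
    (g := { toFun := fun x => pseudoInv (opSqrt R) (V x)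
            map_add' := fun x y => by
              have hx := pseudoInv_spec (opSqrt R) (h (mem_range_self x))
              have hy := pseudoInv_spec (opSqrt R) (h (mem_range_self y))
              conv_lhs => rw [map_add, ← hx.2, ← hy.2, ← map_add]
              exact eq_pseudoInv _ (Submodule.add_mem _ hx.1 hy.1)
            map_smul' := fun c x => by
              have hx := pseudoInv_spec (opSqrt R) (h (mem_range_self x))
              conv_lhs => rw [map_smul, ← hx.2, ← map_smul]
              exact eq_pseudoInv _ (Submodule.smul_mem _ c hx.1) })
    -- Closed graph: limits of minimal preimages stay in the closed space `(ker S)ᗮ`, where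
    -- preimages are unique.
    (fun u x y hu hy => by
      have hmem : y ∈ (LinearMap.ker (opSqrt R).toLinearMap)ᗮ :=
        (Submodule.isClosed_orthogonal _).mem_of_tendsto hy <| Filter.Eventually.of_forall
          fun n => (pseudoInv_spec (opSqrt R) (h (mem_range_self (u n)))).1
      have h1 := ((opSqrt R).continuous.tendsto y).comp hy
      have h2 := (V.continuous.tendsto x).comp hu
      have h3 : opSqrt R y = V x := by
        refine tendsto_nhds_unique h1 (h2.congr fun n => ?_)
        exact (pseudoInv_spec (opSqrt R) (h (mem_range_self (u n)))).2.symm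
      change y = pseudoInv (opSqrt R) (V x)
      rw [← h3, eq_pseudoInv _ hmem])

theorem gammaOp_apply {R V : H →L[ℝ] H} (h : NullControllability R V) (x : H) :
    gammaOp h x = pseudoInv (opSqrt R) (V x) := rfl

theorem opSqrt_gammaOp {R V : H →L[ℝ] H} (h : NullControllability R V) (x : H) :
    opSqrt R (gammaOp h x) = V x :=
  (pseudoInv_spec (opSqrt R) (h (mem_range_self x))).2

theorem gammaNormAt_eq {R V : H →L[ℝ] H} (h : NullControllability R V) (x : H) :
    gammaNormAt R V x = ‖gammaOp h x‖ₑ := by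
  rw [gammaNormAt, if_pos (h (mem_range_self x)), gammaOp_apply]

theorem gammaNorm_lt_top {R V : H →L[ℝ] H} (h : NullControllability R V) :
    gammaNorm R V < ∞ := by
  refine lt_of_le_of_lt (iSup₂_le fun x hx => ?_) (enorm_lt_top (x := gammaOp h))
  rw [gammaNormAt_eq h]
  refine ((gammaOp h).le_opENorm x).trans ?_
  calc ‖gammaOp h‖ₑ * ‖x‖ₑ ≤ ‖gammaOp h‖ₑ * 1 := by
        gcongr
        rw [← ofReal_norm]
        exact ENNReal.ofReal_le_one.2 hx
    _ = _ := mul_one _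

theorem norm_gammaOp_apply_le {R V : H →L[ℝ] H} (h : NullControllability R V) (x : H) :
    ‖gammaOp h x‖ ≤ (gammaNorm R V).toReal * ‖x‖ := by
  have key : ‖gammaOp h‖ ≤ (gammaNorm R V).toReal := by
    refine ContinuousLinearMap.opNorm_le_of_unit_norm ENNReal.toReal_nonneg fun x hx => ?_
    rw [← toReal_enorm, ← gammaNormAt_eq h]
    exact ENNReal.toReal_mono (gammaNorm_lt_top h).ne
      (le_iSup₂ (f := fun (x : H) (_ : ‖x‖ ≤ 1) => gammaNormAt R V x) x hx.le)
  exact (gammaOp h).le_of_opNorm_le key x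

end Operators


/-! ### One-dimensional Cameron-Martin shift and Hölder's inequality. -/

section Gaussian

open ProbabilityTheory
open scoped NNReal

theorem lintegral_gaussianReal_add (c : ℝ) {f : ℝ → ℝ≥0∞} (hf : Measurable f) :
    ∫⁻ z, f (z + c) ∂gaussianReal 0 1
      = ∫⁻ z, ENNReal.ofReal (Real.exp (c * z - c ^ 2 / 2)) * f z ∂gaussianReal 0 1 := by
  rw [← lintegral_map (g := fun z => z + c) hf (by fun_prop), gaussianReal_map_add_const, zero_add,
    gaussianReal_of_var_ne_zero _ one_ne_zero, gaussianReal_of_var_ne_zero _ one_ne_zero,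
    lintegral_withDensity_eq_lintegral_mul _ (measurable_gaussianPDF _ _) hf,
    lintegral_withDensity_eq_lintegral_mul _ (measurable_gaussianPDF _ _) (by fun_prop)]
  refine lintegral_congr fun z => ?_
  simp only [Pi.mul_apply, ← mul_assoc]
  congr 1
  rw [gaussianPDF, gaussianPDF, ← ENNReal.ofReal_mul (gaussianPDFReal_nonneg _ _ _)]
  congr 1
  rw [gaussianPDFReal, gaussianPDFReal, mul_assoc _ (Real.exp _) (Real.exp _),
    ← Real.exp_add]
  congr 2
  simp only [NNReal.coe_one]
  ring

theorem lintegral_gaussianReal_density_rpow (c q : ℝ) (hq : 0 ≤ q) :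
    ∫⁻ z, ENNReal.ofReal (Real.exp (c * z - c ^ 2 / 2)) ^ q ∂gaussianReal 0 1
      = ENNReal.ofReal (Real.exp (q * (q - 1) * c ^ 2 / 2)) := by
  have h1 : ∀ z : ℝ, ENNReal.ofReal (Real.exp (c * z - c ^ 2 / 2)) ^ q
      = ENNReal.ofReal (Real.exp (-(q * c ^ 2 / 2)) * Real.exp (q * c * z)) := fun z => by
    rw [ENNReal.ofReal_rpow_of_nonneg (Real.exp_pos _).le hq, ← Real.exp_mul, ← Real.exp_add]
    ring_nf
  simp_rw [h1]
  rw [← ofReal_integral_eq_lintegral_ofReal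
    ((integrable_exp_mul_gaussianReal (q * c)).const_mul _)
    (Filter.Eventually.of_forall fun z => by positivity), integral_const_mul]
  have h2 := congrFun (mgf_id_gaussianReal (μ := 0) (v := 1)) (q * c)
  simp only [mgf, id] at h2
  rw [h2, ← Real.exp_add]
  congr 2
  simp only [NNReal.coe_one]
  ring

variable {E : Type*} [NormedAddCommGroup E] [NormedSpace ℝ E] [MeasurableSpace E] [BorelSpace E]
  [SecondCountableTopology E]

/-- Shifting by `c • v` only moves the Gaussian coordinate, so it inserts a density `D z` that does
not involve `ρ`. Hölder on the product space separates `D` from `f`. -/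
theorem lintegral_shift_gaussian_conv_le (v : E) (ρ : Measure E) [IsProbabilityMeasure ρ]
    (c : ℝ) {p : ℝ} (hp : 1 < p) {f : E → ℝ≥0∞} (hf : Measurable f) :
    ∫⁻ x, f (c • v + x) ∂((gaussianReal 0 1).map (fun z : ℝ => z • v) ∗ ρ)
      ≤ ENNReal.ofReal (Real.exp (c ^ 2 / (2 * (p - 1))))
        * (∫⁻ x, f x ^ p ∂((gaussianReal 0 1).map (fun z : ℝ => z • v) ∗ ρ)) ^ (1 / p) := by
  have hp0 : (0 : ℝ) < p - 1 := by linarith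
  have conv_eq : ∀ g : E → ℝ≥0∞, Measurable g →
      ∫⁻ x, g x ∂((gaussianReal 0 1).map (fun z : ℝ => z • v) ∗ ρ)
        = ∫⁻ w, ∫⁻ z, g (z • v + w) ∂gaussianReal 0 1 ∂ρ := by
    intro g hg
    rw [Measure.lintegral_conv hg, lintegral_map (by fun_prop) (by fun_prop),
      lintegral_lintegral_swap (by fun_prop)]
  have hpq := Real.HolderConjugate.conjExponent hp
  set q := p.conjExponent with hq
  have hqe : q = p / (p - 1) := rfl
  let D : ℝ → ℝ≥0∞ := fun z => ENNReal.ofReal (Real.exp (c * z - c ^ 2 / 2))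
  have hD : Measurable D := by fun_prop
  rw [conv_eq _ (by fun_prop), conv_eq _ (by fun_prop)]
  have h1 : ∀ w, ∫⁻ z, f (c • v + (z • v + w)) ∂gaussianReal 0 1
      = ∫⁻ z, D z * f (z • v + w) ∂gaussianReal 0 1 := by
    intro w
    rw [← lintegral_gaussianReal_add c (f := fun z => f (z • v + w)) (by fun_prop)]
    refine lintegral_congr fun z => ?_
    congr 1
    rw [add_smul]; abel
  simp_rw [h1]
  rw [← lintegral_prod_symm' (μ := gaussianReal 0 1) (ν := ρ)
      (fun y : ℝ × E => D y.1 * f (y.1 • v + y.2)) (by fun_prop),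
    ← lintegral_prod_symm' (μ := gaussianReal 0 1) (ν := ρ)
      (fun y : ℝ × E => f (y.1 • v + y.2) ^ p) (by fun_prop), mul_comm]
  -- The exponent is `(q - 1) c² / 2`, and `q - 1 = 1 / (p - 1)` for the conjugate exponent.
  have h2 : (∫⁻ y, D y.1 ^ q ∂(gaussianReal 0 1).prod ρ) ^ (1 / q)
      = ENNReal.ofReal (Real.exp (c ^ 2 / (2 * (p - 1)))) := by
    rw [lintegral_prod _ (by fun_prop)]
    simp only [lintegral_const, measure_univ, mul_one]
    rw [lintegral_gaussianReal_density_rpow c q hpq.symm.nonneg,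
      ENNReal.ofReal_rpow_of_pos (Real.exp_pos _), ← Real.exp_mul]
    congr 2
    rw [hqe]
    field_simp
    ring
  rw [← h2]
  calc _ = ∫⁻ y, ((fun y : ℝ × E => f (y.1 • v + y.2)) * fun y : ℝ × E => D y.1) y
        ∂(gaussianReal 0 1).prod ρ := by
        refine lintegral_congr fun y => ?_
        rw [Pi.mul_apply, mul_comm]
    _ ≤ _ := ENNReal.lintegral_mul_le_Lp_mul_Lq _ hpq (by fun_prop) (by fun_prop)

end Gaussian

/-! ### Compound Poisson laws. -/

section CompoundPoisson

variable {E : Type*} [NormedAddCommGroup E] [InnerProductSpace ℝ E] [MeasurableSpace E]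
  [BorelSpace E] [SecondCountableTopology E]

/-- Convolution powers of a measure. -/
noncomputable def convPow (m : Measure E) : ℕ → Measure E
  | 0 => Measure.dirac 0
  | n + 1 => convPow m n ∗ m

instance isFiniteMeasure_convPow (m : Measure E) [IsFiniteMeasure m] (n : ℕ) :
    IsFiniteMeasure (convPow m n) := by
  induction n with
  | zero => rw [convPow]; infer_instance
  | succ n ih => rw [convPow]; infer_instance

theorem charFun_convPow (m : Measure E) [IsFiniteMeasure m] (n : ℕ) (ξ : E) :
    charFun (convPow m n) ξ = charFun m ξ ^ n := by
  induction n with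
  | zero => simp [convPow]
  | succ n ih => rw [convPow, charFun_conv, ih, pow_succ]

theorem convPow_univ (m : Measure E) [IsFiniteMeasure m] (n : ℕ) :
    convPow m n univ = m univ ^ n := by
  induction n with
  | zero => simp [convPow]
  | succ n ih =>
    have h := Measure.lintegral_conv (μ := convPow m n) (ν := m) (f := fun _ => 1)
      measurable_const
    simp only [lintegral_const, one_mul] at h
    rw [convPow, h, ih, pow_succ, mul_comm]

/-- The compound Poisson distribution with finite intensity measure `m`. -/
noncomputable def compoundPoisson (m : Measure E) : Measure E :=
  ENNReal.ofReal (Real.exp (-m.real univ)) •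
    Measure.sum fun n => ENNReal.ofReal ((n.factorial : ℝ)⁻¹) • convPow m n

instance isProbabilityMeasure_compoundPoisson (m : Measure E) [IsFiniteMeasure m] :
    IsProbabilityMeasure (compoundPoisson m) := by
  constructor
  have h := NormedSpace.expSeries_div_hasSum_exp (m.real univ)
  have h1 : ∀ n : ℕ, (ENNReal.ofReal ((n.factorial : ℝ)⁻¹) • convPow m n) univ
      = ENNReal.ofReal (m.real univ ^ n / n.factorial) := fun n => by
    rw [Measure.smul_apply, convPow_univ, smul_eq_mul, div_eq_inv_mul,
      ENNReal.ofReal_mul (by positivity), ENNReal.ofReal_pow measureReal_nonneg,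
      ofReal_measureReal]
  rw [compoundPoisson, Measure.smul_apply, Measure.sum_apply _ MeasurableSet.univ]
  simp_rw [h1]
  rw [← ENNReal.ofReal_tsum_of_nonneg (fun n => by positivity) h.summable, h.tsum_eq,
    ← Real.exp_eq_exp_ℝ, smul_eq_mul, ← ENNReal.ofReal_mul (Real.exp_pos _).le, ← Real.exp_add]
  simp

theorem charFun_compoundPoisson (m : Measure E) [IsFiniteMeasure m] (ξ : E) :
    charFun (compoundPoisson m) ξ = Complex.exp (charFun m ξ - m.real univ) := by
  have hint : Integrable (fun x => Complex.exp (⟪x, ξ⟫ * Complex.I)) (compoundPoisson m) :=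
    Integrable.of_bound (by fun_prop) 1
      (Filter.Eventually.of_forall fun x => by rw [Complex.norm_exp_ofReal_mul_I])
  have hpos : ENNReal.ofReal (Real.exp (-m.real univ)) ≠ 0 := by
    simpa using Real.exp_pos _
  rw [compoundPoisson, integrable_smul_measure hpos ENNReal.ofReal_ne_top] at hint
  have h2 := hasSum_integral_measure hint
  have h3 : ∀ n : ℕ, ∫ x, Complex.exp (⟪x, ξ⟫ * Complex.I)
      ∂(ENNReal.ofReal ((n.factorial : ℝ)⁻¹) • convPow m n) = charFun m ξ ^ n / n.factorial := by
    intro n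
    rw [integral_smul_measure, ENNReal.toReal_ofReal (by positivity), ← charFun_apply,
      charFun_convPow, Complex.real_smul, div_eq_inv_mul]
    simp
  simp_rw [h3] at h2
  have h4 := h2.unique (NormedSpace.expSeries_div_hasSum_exp (charFun m ξ))
  rw [charFun_apply, compoundPoisson, integral_smul_measure, h4,
    ENNReal.toReal_ofReal (Real.exp_pos _).le, ← Complex.exp_eq_exp_ℂ, Complex.real_smul,
    Complex.ofReal_exp, ← Complex.exp_add]
  congr 1
  push_cast
  ring

end CompoundPoisson


/-! ### Lévy-Khintchine exponents and approximate splitting of the law. -/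

section LevyTriplet

open ProbabilityTheory Filter
open scoped NNReal Topology

variable {H : Type*} [NormedAddCommGroup H] [InnerProductSpace ℝ H]

/-- The integrand in the Lévy-Khintchine exponent. -/
noncomputable def levyIntegrand (ξ x : H) : ℂ :=
  Complex.exp (Complex.I * (⟪ξ, x⟫ : ℂ)) - 1 - Complex.I * (⟪ξ, x⟫ : ℂ) / (1 + (‖x‖ : ℂ) ^ 2)

theorem norm_exp_I_mul_sub_one_sub_le (u : ℝ) :
    ‖Complex.exp (Complex.I * (u : ℂ)) - 1 - Complex.I * u‖ ≤ 3 * u ^ 2 := by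
  have hn : ‖Complex.I * (u : ℂ)‖ = |u| := by simp
  rcases le_total |u| 1 with h | h
  · refine (Complex.norm_exp_sub_one_sub_id_le (hn.trans_le h)).trans ?_
    rw [hn, sq_abs]
    nlinarith [sq_nonneg u]
  · refine (norm_sub_le _ _).trans ?_
    rw [hn]
    have h1 := Real.norm_exp_I_mul_ofReal_sub_one_le (x := u)
    rw [Real.norm_eq_abs] at h1
    nlinarith [sq_abs u]

theorem norm_levyIntegrand_le (ξ x : H) :
    ‖levyIntegrand ξ x‖ ≤ (2 + ‖ξ‖ + 3 * ‖ξ‖ ^ 2) * min 1 (‖x‖ ^ 2) := by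
  have hpos : (0 : ℝ) < 1 + ‖x‖ ^ 2 := by positivity
  have hu : |⟪ξ, x⟫| ≤ ‖ξ‖ * ‖x‖ := abs_real_inner_le_norm ξ x
  have hden : ‖(1 + (‖x‖ : ℂ) ^ 2)‖ = 1 + ‖x‖ ^ 2 := by
    rw [← Complex.ofReal_one, ← Complex.ofReal_pow, ← Complex.ofReal_add, Complex.norm_real,
      Real.norm_of_nonneg hpos.le]
  have hξ := norm_nonneg ξ
  have hx := norm_nonneg x
  rcases le_total 1 ‖x‖ with h | h
  · rw [min_eq_left (by nlinarith), mul_one]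
    have h1 : ‖Complex.exp (Complex.I * (⟪ξ, x⟫ : ℂ)) - 1‖ ≤ 2 := by
      refine (norm_sub_le _ _).trans ?_
      rw [mul_comm, Complex.norm_exp_ofReal_mul_I, norm_one]
      norm_num
    have h2 : ‖Complex.I * (⟪ξ, x⟫ : ℂ) / (1 + (‖x‖ : ℂ) ^ 2)‖ ≤ ‖ξ‖ := by
      rw [norm_div, hden, norm_mul, Complex.norm_I, one_mul, Complex.norm_real, Real.norm_eq_abs,
        div_le_iff₀ hpos]
      refine hu.trans ?_
      gcongr
      nlinarith
    refine (norm_sub_le _ _).trans ?_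
    nlinarith
  · rw [min_eq_right (by nlinarith)]
    -- Near the origin, compare with the second-order Taylor remainder; replacing the compensator `i
    -- u / (1 + |x|²)` by `i u` costs only a term of order `|x|³`.
    have e : levyIntegrand ξ x = (Complex.exp (Complex.I * (⟪ξ, x⟫ : ℂ)) - 1
        - Complex.I * (⟪ξ, x⟫ : ℝ)) + Complex.I * (⟪ξ, x⟫ : ℂ) * (‖x‖ : ℂ) ^ 2
          / (1 + (‖x‖ : ℂ) ^ 2) := by
      have h0 : (1 + (‖x‖ : ℂ) ^ 2) ≠ 0 := by
        rw [← norm_pos_iff, hden]; exact hpos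
      rw [levyIntegrand]
      field_simp
      ring
    have h1 := norm_exp_I_mul_sub_one_sub_le ⟪ξ, x⟫
    have h2 : ⟪ξ, x⟫ ^ 2 ≤ ‖ξ‖ ^ 2 * ‖x‖ ^ 2 := by
      rw [← sq_abs, ← mul_pow]
      gcongr
    have h3 : ‖Complex.I * (⟪ξ, x⟫ : ℂ) * (‖x‖ : ℂ) ^ 2 / (1 + (‖x‖ : ℂ) ^ 2)‖
        ≤ ‖ξ‖ * ‖x‖ ^ 2 := by
      rw [norm_div, hden, norm_mul, norm_mul, Complex.norm_I, one_mul, Complex.norm_real,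
        Real.norm_eq_abs, norm_pow, Complex.norm_real, norm_norm, div_le_iff₀ hpos]
      calc |⟪ξ, x⟫| * ‖x‖ ^ 2 ≤ (‖ξ‖ * 1) * ‖x‖ ^ 2 := by
            gcongr
            exact hu.trans (by gcongr)
        _ ≤ ‖ξ‖ * ‖x‖ ^ 2 * (1 + ‖x‖ ^ 2) := by
            rw [mul_one]
            exact le_mul_of_one_le_right (by positivity) (by nlinarith [sq_nonneg ‖x‖])
    rw [e]
    refine (norm_add_le _ _).trans ?_
    nlinarith [sq_nonneg ‖x‖]

variable [MeasurableSpace H] [BorelSpace H] [SecondCountableTopology H]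

theorem IsLevyMeasure.integrable_min {m : Measure H} (hm : IsLevyMeasure m) :
    Integrable (fun x => min 1 (‖x‖ ^ 2)) m := by
  refine ⟨by fun_prop, ?_⟩
  rw [hasFiniteIntegral_iff_ofReal (Eventually.of_forall fun x => by positivity)]
  exact hm.lintegral_lt_top

theorem IsLevyMeasure.integrable_levyIntegrand {m : Measure H} (hm : IsLevyMeasure m) (ξ : H) :
    Integrable (levyIntegrand ξ) m := by
  refine (hm.integrable_min.const_mul (2 + ‖ξ‖ + 3 * ‖ξ‖ ^ 2)).mono' ?_
    (Eventually.of_forall fun x => norm_levyIntegrand_le ξ x)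
  refine Measurable.aestronglyMeasurable ?_
  unfold levyIntegrand
  fun_prop

/-- The complement of the ball of radius `1 / (n + 1)`. -/
def outerRegion (H : Type*) [NormedAddCommGroup H] (n : ℕ) : Set H :=
  {x | 1 / ((n : ℝ) + 1) ≤ ‖x‖}

theorem measurableSet_outerRegion (n : ℕ) : MeasurableSet (outerRegion H n) :=
  measurableSet_le measurable_const measurable_norm

theorem monotone_outerRegion : Monotone (outerRegion H) := by
  intro i j hij x hx
  exact (Nat.one_div_le_one_div (α := ℝ) hij).trans (mem_ofPred_eq.mp hx)

theorem mem_iUnion_outerRegion {x : H} (hx : x ≠ 0) : x ∈ ⋃ n, outerRegion H n := by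
  obtain ⟨n, hn⟩ := exists_nat_one_div_lt (norm_pos_iff.2 hx)
  exact mem_iUnion.2 ⟨n, hn.le⟩

theorem IsLevyMeasure.isFiniteMeasure_restrict {m : Measure H} (hm : IsLevyMeasure m) (n : ℕ) :
    IsFiniteMeasure (m.restrict (outerRegion H n)) := by
  constructor
  rw [Measure.restrict_apply_univ]
  have hε : (0 : ℝ) < 1 / ((n : ℝ) + 1) := by positivity
  refine lt_of_le_of_lt (measure_mono fun x hx => ?_)
    (hm.integrable_min.measure_norm_ge_lt_top (ε := min 1 ((1 / ((n : ℝ) + 1)) ^ 2))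
      (by positivity))
  have hx' : 1 / ((n : ℝ) + 1) ≤ ‖x‖ := hx
  rw [mem_ofPred_eq, Real.norm_of_nonneg (by positivity)]
  gcongr

variable [CompleteSpace H]

/-- Infinitely divisible laws without Gaussian part that approximate `D[a, 0, m]`. -/
noncomputable def jumpApprox (a : H) (m : Measure H) (n : ℕ) : Measure H :=
  compoundPoisson (m.restrict (outerRegion H n)) ∗
    Measure.dirac (a - ∫ x in outerRegion H n, (1 + ‖x‖ ^ 2)⁻¹ • x ∂m)

theorem isProbabilityMeasure_jumpApprox (a : H) {m : Measure H} (hm : IsLevyMeasure m) (n : ℕ) :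
    IsProbabilityMeasure (jumpApprox a m n) := by
  have := hm.isFiniteMeasure_restrict n
  rw [jumpApprox]
  infer_instance

/-- Away from the origin `m` is finite, so the terms of the Lévy-Khintchine integrand can be
integrated separately: the compound Poisson law supplies `exp (i u) - 1`, the Dirac shift the drift
and the compensator. -/
theorem charFun_jumpApprox (a : H) {m : Measure H} (hm : IsLevyMeasure m) (n : ℕ) (ξ : H) :
    charFun (jumpApprox a m n) ξ = Complex.exp (Complex.I * (⟪a, ξ⟫ : ℂ)
      + ∫ x in outerRegion H n, levyIntegrand ξ x ∂m) := by
  have := hm.isFiniteMeasure_restrict n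
  set M := m.restrict (outerRegion H n) with hM
  have hb : Integrable (fun x : H => (1 + ‖x‖ ^ 2)⁻¹ • x) M := by
    refine Integrable.of_bound (by fun_prop) 1 (Eventually.of_forall fun x => ?_)
    have hpos : (0 : ℝ) < 1 + ‖x‖ ^ 2 := by positivity
    rw [norm_smul, Real.norm_of_nonneg (by positivity), inv_mul_le_iff₀ hpos]
    nlinarith [sq_nonneg (‖x‖ - 1), norm_nonneg x]
  have h1 : Integrable (fun x => Complex.exp (⟪x, ξ⟫ * Complex.I)) M :=
    Integrable.of_bound (by fun_prop) 1
      (Eventually.of_forall fun x => by rw [Complex.norm_exp_ofReal_mul_I])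
  have h2 : Integrable (fun x : H => (⟪ξ, (1 + ‖x‖ ^ 2)⁻¹ • x⟫ : ℝ)) M := hb.const_inner ξ
  have h3 : ∫ x, (⟪ξ, (1 + ‖x‖ ^ 2)⁻¹ • x⟫ : ℝ) ∂M = ⟪ξ, ∫ x, (1 + ‖x‖ ^ 2)⁻¹ • x ∂M⟫ :=
    integral_inner hb ξ
  have h4 : ∫ x, levyIntegrand ξ x ∂M = charFun M ξ - M.real univ
      - Complex.I * (⟪ξ, ∫ x, (1 + ‖x‖ ^ 2)⁻¹ • x ∂M⟫ : ℝ) := by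
    rw [← h3, ← integral_complex_ofReal, ← integral_const_mul, charFun_apply]
    have h5 : ((M.real univ : ℝ) : ℂ) = ∫ x, (1 : ℂ) ∂M := by simp
    have h6 : Integrable (fun x => Complex.exp (⟪x, ξ⟫ * Complex.I) - 1) M :=
      h1.sub (integrable_const _)
    have h7 : Integrable (fun x : H => Complex.I * (⟪ξ, (1 + ‖x‖ ^ 2)⁻¹ • x⟫ : ℝ)) M :=
      h2.ofReal.const_mul _
    rw [h5, ← integral_sub h1 (integrable_const _), ← integral_sub h6 h7]
    refine integral_congr_ae (Eventually.of_forall fun x => ?_)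
    simp only [levyIntegrand, real_inner_smul_right, real_inner_comm ξ x]
    push_cast
    rw [mul_comm Complex.I, mul_comm Complex.I]
    ring
  rw [h4, jumpApprox, charFun_conv, charFun_compoundPoisson, charFun_dirac, ← Complex.exp_add,
    inner_sub_left, ← hM, real_inner_comm _ ξ]
  congr 1
  push_cast
  ring

theorem tendsto_charFun_jumpApprox (a : H) {m : Measure H} (hm : IsLevyMeasure m) (ξ : H) :
    Tendsto (fun n => charFun (jumpApprox a m n) ξ) atTop
      (𝓝 (Complex.exp (-levyExponent a 0 m ξ))) := by
  have h1 := tendsto_setIntegral_of_monotone (fun n => measurableSet_outerRegion (H := H) n)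
    monotone_outerRegion (hm.integrable_levyIntegrand ξ).integrableOn
  -- The outer regions miss only `0`, where the integrand vanishes.
  rw [setIntegral_eq_integral_of_forall_compl_eq_zero (s := ⋃ n, outerRegion H n) (fun x hx => by
    have : x = 0 := by
      by_contra h
      exact hx (mem_iUnion_outerRegion h)
    simp [levyIntegrand, this])] at h1
  simp_rw [charFun_jumpApprox a hm]
  have h2 : -levyExponent a 0 m ξ = Complex.I * (⟪a, ξ⟫ : ℂ) + ∫ x, levyIntegrand ξ x ∂m := by
    simp [levyExponent, levyIntegrand]
    ring
  rw [h2]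
  exact (Complex.continuous_exp.tendsto _).comp (tendsto_const_nhds.add h1)

theorem levyExponent_eq_add (a : H) (R : H →L[ℝ] H) (m : Measure H) (ξ : H) :
    levyExponent a R m ξ = (1 / 2 : ℂ) * (⟪ξ, R ξ⟫ : ℂ) + levyExponent a 0 m ξ := by
  simp [levyExponent]
  ring

variable {E : Type*} [NormedAddCommGroup E] [InnerProductSpace ℝ E] [FiniteDimensional ℝ E]
  [MeasurableSpace E] [BorelSpace E]

theorem charFun_map_adjoint {F : Type*} [NormedAddCommGroup F] [InnerProductSpace ℝ F]
    [CompleteSpace F] [MeasurableSpace F] [BorelSpace F] (μ : Measure H) (L : H →L[ℝ] F) (η : F) :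
    charFun (μ.map L) η = charFun μ (L.adjoint η) := by
  rw [charFun_apply, charFun_apply, integral_map (by fun_prop) (by fun_prop)]
  simp_rw [ContinuousLinearMap.adjoint_inner_right]

theorem isPositive_one_sub_rankOne {e : H} (he : ‖e‖ ≤ 1) :
    (1 - InnerProductSpace.rankOne ℝ e e : H →L[ℝ] H).IsPositive := by
  refine ⟨fun x y => ?_, fun x => ?_⟩
  · simp [inner_sub_left, inner_sub_right, real_inner_smul_right, real_inner_comm, mul_comm]
  · simp only [ContinuousLinearMap.reApplyInnerSelf_apply, inner_sub_left, sub_apply,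
      one_apply_eq_self, RCLike.re_to_real, real_inner_self_eq_norm_sq,
      InnerProductSpace.rankOne_apply, real_inner_smul_left]
    have h1 : |⟪e, x⟫| ≤ ‖x‖ := (abs_real_inner_le_norm e x).trans
      (mul_le_of_le_one_left (norm_nonneg x) he)
    have h2 : ⟪e, x⟫ ^ 2 ≤ ‖x‖ ^ 2 := by rw [← sq_abs]; gcongr
    nlinarith

/-- In a finite-dimensional space there is a centred Gaussian measure with covariance
`A (1 - e ⊗ e) Aᵀ`. -/
theorem exists_gaussian_compl (A : H →L[ℝ] E) {e : H} (he : ‖e‖ ≤ 1) :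
    ∃ g : Measure E, IsProbabilityMeasure g ∧ ∀ η, charFun g η
      = Complex.exp (-((‖A.adjoint η‖ ^ 2 - ⟪e, A.adjoint η⟫ ^ 2 : ℝ) : ℂ) / 2) := by
  have hpos := (isPositive_one_sub_rankOne he).conj_adjoint A
  -- The image of the standard Gaussian under `T` has covariance `T²`.
  obtain ⟨T, hT, hTT⟩ := exists_isPositive_comp_self hpos
  refine ⟨(stdGaussian E).map T, Measure.isProbabilityMeasure_map (by fun_prop), fun η => ?_⟩
  rw [charFun_map_adjoint, charFun_stdGaussian, hT.isSelfAdjoint.adjoint_eq]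
  have h1 : ‖T η‖ ^ 2 = ‖A.adjoint η‖ ^ 2 - ⟪e, A.adjoint η⟫ ^ 2 := by
    rw [← real_inner_self_eq_norm_sq, ← hT.inner_left_eq_inner_right,
      show T (T η) = (T.comp T) η from rfl, hTT]
    simp only [ContinuousLinearMap.comp_apply]
    rw [← ContinuousLinearMap.adjoint_inner_right]
    simp [inner_sub_left, real_inner_smul_left]
    ring
  rw [← h1]
  push_cast
  ring_nf

theorem charFun_map_smul_gaussianReal {F : Type*} [NormedAddCommGroup F] [InnerProductSpace ℝ F]
    [MeasurableSpace F] [BorelSpace F] [SecondCountableTopology F] (v η : F) :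
    charFun ((gaussianReal 0 1).map (fun z : ℝ => z • v)) η
      = Complex.exp (-((⟪v, η⟫ ^ 2 : ℝ) : ℂ) / 2) := by
  have h := charFun_gaussianReal (μ := 0) (v := 1) ⟪v, η⟫
  rw [charFun_apply] at h ⊢
  rw [integral_map (by fun_prop) (by fun_prop)]
  simp only [real_inner_smul_left]
  simp only [RCLike.inner_apply, conj_trivial] at h
  simp_rw [mul_comm _ ⟪v, η⟫]
  convert h using 2
  push_cast
  simp
  ring

/-- The covariance of the projected law splits into the rank-one part carried by `L (S e)` and a
nonnegative remainder, because `‖e‖ ≤ 1`. Hence the convolutions differ from the projected law only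
in the truncated jump part. -/
theorem exists_tendsto_gaussian_conv {μ : Measure H} {a : H} {R : H →L[ℝ] H} {m : Measure H}
    (hμ : HasLevyTriplet μ a R m) (L : H →L[ℝ] E) {e : H} (he : ‖e‖ ≤ 1) :
    ∃ ρ : ℕ → Measure E, (∀ n, IsProbabilityMeasure (ρ n)) ∧ ∀ η, Tendsto (fun n =>
      charFun ((gaussianReal 0 1).map (fun z : ℝ => z • L (opSqrt R e)) ∗ ρ n) η) atTop
        (𝓝 (charFun (μ.map L) η)) := by
  obtain ⟨hS, hSS⟩ := opSqrt_spec hμ.isPositiveTraceClass.isPositive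
  obtain ⟨g, hg, hgc⟩ := exists_gaussian_compl (L.comp (opSqrt R)) he
  have hj := isProbabilityMeasure_jumpApprox a hμ.isLevyMeasure
  have hjL : ∀ n, IsProbabilityMeasure ((jumpApprox a m n).map L) :=
    fun n => Measure.isProbabilityMeasure_map (by fun_prop)
  have hγ : IsProbabilityMeasure ((gaussianReal 0 1).map (fun z : ℝ => z • L (opSqrt R e))) :=
    Measure.isProbabilityMeasure_map (by fun_prop)
  refine ⟨fun n => g ∗ (jumpApprox a m n).map L, fun n => inferInstance, fun η => ?_⟩
  have hadj : (L.comp (opSqrt R)).adjoint η = opSqrt R (L.adjoint η) := by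
    rw [ContinuousLinearMap.adjoint_comp, hS.isSelfAdjoint.adjoint_eq]
    rfl
  have hv : ⟪L (opSqrt R e), η⟫ = ⟪e, opSqrt R (L.adjoint η)⟫ := by
    rw [← hadj, ContinuousLinearMap.adjoint_inner_right]
    rfl
  have hnorm : ‖opSqrt R (L.adjoint η)‖ ^ 2 = ⟪L.adjoint η, R (L.adjoint η)⟫ := by
    conv_rhs => rw [← hSS]
    rw [← real_inner_self_eq_norm_sq, ← hS.inner_left_eq_inner_right, real_inner_comm]
    rfl
  have h1 : ∀ n, charFun ((gaussianReal 0 1).map (fun z : ℝ => z • L (opSqrt R e)) ∗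
      (g ∗ (jumpApprox a m n).map L)) η
      = Complex.exp (-((1 / 2 : ℂ) * (⟪L.adjoint η, R (L.adjoint η)⟫ : ℂ)))
        * charFun (jumpApprox a m n) (L.adjoint η) := by
    intro n
    rw [charFun_conv, charFun_conv, charFun_map_smul_gaussianReal, hgc, charFun_map_adjoint,
      ← mul_assoc, ← Complex.exp_add, hadj, hv, ← hnorm]
    congr 2
    push_cast
    ring
  simp_rw [h1]
  rw [charFun_map_adjoint, hμ.charFun_eq, levyExponent_eq_add, neg_add, Complex.exp_add]
  exact (tendsto_charFun_jumpApprox a hμ.isLevyMeasure _).const_mul _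

end LevyTriplet


/-! ### The shift inequality for laws with a Lévy triplet. -/

section Shift

open ProbabilityTheory Filter
open scoped NNReal Topology

theorem tendsto_lintegral_of_continuous_of_le {Ω : Type*} [MeasurableSpace Ω] [TopologicalSpace Ω]
    [OpensMeasurableSpace Ω] {μs : ℕ → ProbabilityMeasure Ω} {μ : ProbabilityMeasure Ω}
    (h : Tendsto μs atTop (𝓝 μ)) {f : Ω → ℝ≥0} (hf : Continuous f) {M : ℝ≥0}
    (hM : ∀ x, f x ≤ M) :
    Tendsto (fun n => ∫⁻ x, f x ∂(μs n : Measure Ω)) atTop (𝓝 (∫⁻ x, f x ∂(μ : Measure Ω))) := by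
  let g : BoundedContinuousFunction Ω ℝ≥0 :=
    BoundedContinuousFunction.mkOfBound ⟨f, hf⟩ M fun x y => by
      rw [NNReal.dist_eq]
      refine abs_sub_le_of_nonneg_of_le ?_ ?_ ?_ ?_ <;> first | exact NNReal.coe_nonneg _ | exact hM _
  exact (ProbabilityMeasure.tendsto_iff_forall_lintegral_tendsto.1 h) g

variable {H : Type*} [NormedAddCommGroup H] [InnerProductSpace ℝ H] [MeasurableSpace H]
  [BorelSpace H] [SecondCountableTopology H] [CompleteSpace H]

theorem lintegral_shift_map_le {E : Type*} [NormedAddCommGroup E] [InnerProductSpace ℝ E]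
    [FiniteDimensional ℝ E] [MeasurableSpace E] [BorelSpace E]
    {μ : Measure H} {a : H} {R : H →L[ℝ] H} {m : Measure H} (hμ : HasLevyTriplet μ a R m)
    (L : H →L[ℝ] E) {e : H} (he : ‖e‖ ≤ 1) (c : ℝ) {p : ℝ} (hp : 1 < p) {f : E → ℝ≥0}
    (hf : Continuous f) {M : ℝ≥0} (hM : ∀ x, f x ≤ M) :
    ∫⁻ x, f (c • L (opSqrt R e) + x) ∂(μ.map L)
      ≤ ENNReal.ofReal (Real.exp (c ^ 2 / (2 * (p - 1))))
        * (∫⁻ x, (f x : ℝ≥0∞) ^ p ∂(μ.map L)) ^ (1 / p) := by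
  have := hμ.isProbabilityMeasure
  obtain ⟨ρ, hρ, hlim⟩ := exists_tendsto_gaussian_conv hμ L he
  set v := L (opSqrt R e)
  have hγ : IsProbabilityMeasure ((gaussianReal 0 1).map (fun z : ℝ => z • v)) :=
    Measure.isProbabilityMeasure_map (by fun_prop)
  have hμL : IsProbabilityMeasure (μ.map L) := Measure.isProbabilityMeasure_map (by fun_prop)
  -- Lévy's continuity theorem; this is where finite dimension of `E` is needed.
  have hw : Tendsto (β := ProbabilityMeasure E)
      (fun n => ⟨(gaussianReal 0 1).map (fun z : ℝ => z • v) ∗ ρ n, inferInstance⟩) atTop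
      (𝓝 ⟨μ.map L, hμL⟩) := ProbabilityMeasure.tendsto_iff_tendsto_charFun.2 hlim
  have hp0 : 0 ≤ p := by linarith
  have h1 := tendsto_lintegral_of_continuous_of_le hw (f := fun x => f (c • v + x)) (by fun_prop)
    (fun x => hM _)
  have h2 := tendsto_lintegral_of_continuous_of_le hw (f := fun x => f x ^ p)
    ((NNReal.continuous_rpow_const hp0).comp hf) (fun x => NNReal.rpow_le_rpow (hM x) hp0)
  simp_rw [ENNReal.coe_rpow_of_nonneg _ hp0] at h2
  have h3 := ENNReal.Tendsto.const_mul (a := ENNReal.ofReal (Real.exp (c ^ 2 / (2 * (p - 1)))))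
    ((ENNReal.continuous_rpow_const (y := 1 / p)).tendsto _ |>.comp h2)
    (Or.inr ENNReal.ofReal_ne_top)
  refine le_of_tendsto_of_tendsto' h1 h3 fun n => ?_
  exact lintegral_shift_gaussian_conv_le v (ρ n) c hp (f := fun x => (f x : ℝ≥0∞)) (by fun_prop)

theorem exists_finiteDimensional_starProjection_tendsto (H : Type*) [NormedAddCommGroup H]
    [InnerProductSpace ℝ H] [SecondCountableTopology H] :
    ∃ V : ℕ → Submodule ℝ H, ∃ _ : ∀ n, FiniteDimensional ℝ (V n),
      ∀ x, Tendsto (fun n => (V n).starProjection x) atTop (𝓝 x) := by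
  let V : ℕ → Submodule ℝ H := fun n =>
    Submodule.span ℝ (TopologicalSpace.denseSeq H '' Iio n)
  have hfin : ∀ n, FiniteDimensional ℝ (V n) := fun n =>
    FiniteDimensional.span_of_finite ℝ ((finite_Iio n).image _)
  refine ⟨V, hfin, fun x => ?_⟩
  refine Submodule.starProjection_tendsto_self V (fun i j hij => ?_) x ?_
  · exact Submodule.span_mono (image_mono (Iio_subset_Iio hij))
  · intro y _
    have h1 : range (TopologicalSpace.denseSeq H) ⊆ (⨆ n, V n : Submodule ℝ H) := by
      rintro _ ⟨i, rfl⟩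
      exact (le_iSup V (i + 1)) (Submodule.subset_span ⟨i, by simp, rfl⟩)
    exact closure_mono h1 (TopologicalSpace.denseRange_denseSeq H y)

/-- Orthogonal projections onto an increasing sequence of finite-dimensional spaces converge
strongly to the identity. The constant is the same for all of them, so dominated convergence
suffices. -/
theorem lintegral_shift_le_of_continuous
    {μ : Measure H} {a : H} {R : H →L[ℝ] H} {m : Measure H} (hμ : HasLevyTriplet μ a R m)
    (k : H) {p : ℝ} (hp : 1 < p) {f : H → ℝ≥0} (hf : Continuous f) {M : ℝ≥0}
    (hM : ∀ x, f x ≤ M) :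
    ∫⁻ x, f (opSqrt R k + x) ∂μ
      ≤ ENNReal.ofReal (Real.exp (‖k‖ ^ 2 / (2 * (p - 1))))
        * (∫⁻ x, (f x : ℝ≥0∞) ^ p ∂μ) ^ (1 / p) := by
  have := hμ.isProbabilityMeasure
  have hp0 : 0 ≤ p := by linarith
  obtain ⟨V, hV, hlim⟩ := exists_finiteDimensional_starProjection_tendsto H
  -- For `k = 0` this is `0`, which is why only `‖e‖ ≤ 1` is asked for.
  let e : H := ‖k‖⁻¹ • k
  have he : ‖e‖ ≤ 1 := by
    rw [norm_smul, norm_inv, norm_norm]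
    exact inv_mul_le_one
  have hk : ‖k‖ • e = k := by
    rcases eq_or_ne k 0 with h | h
    · simp [h]
    · rw [smul_smul, mul_inv_cancel₀ (norm_ne_zero_iff.2 h), one_smul]
  have hdct : ∀ {g : H → ℝ≥0} (_ : Continuous g) {N : ℝ≥0} (_ : ∀ x, g x ≤ N) (u : ℕ → H → H)
      (_ : ∀ n, Continuous (u n)) (w : H → H) (_ : ∀ x, Tendsto (fun n => u n x) atTop (𝓝 (w x))),
      Tendsto (fun n => ∫⁻ x, g (u n x) ∂μ) atTop (𝓝 (∫⁻ x, g (w x) ∂μ)) := by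
    intro g hg N hN u hu w hw
    refine tendsto_lintegral_of_dominated_convergence (fun _ => (N : ℝ≥0∞))
      (fun n => ?_) (fun n => Eventually.of_forall fun x => ?_) ?_ (Eventually.of_forall fun x => ?_)
    · exact (ENNReal.continuous_coe.comp (hg.comp (hu n))).measurable
    · exact ENNReal.coe_le_coe.2 (hN _)
    · simp
    · exact (ENNReal.continuous_coe.tendsto _).comp ((hg.tendsto _).comp (hw x))
  have hn : ∀ n, ∫⁻ x, f ((V n).starProjection (opSqrt R k) + (V n).starProjection x) ∂μ
      ≤ ENNReal.ofReal (Real.exp (‖k‖ ^ 2 / (2 * (p - 1))))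
        * (∫⁻ x, (f ((V n).starProjection x) : ℝ≥0∞) ^ p ∂μ) ^ (1 / p) := by
    intro n
    have h1 := lintegral_shift_map_le hμ (V n).orthogonalProjectionOnto he ‖k‖ hp
      (f := fun y : V n => f y) (by fun_prop) (fun y => hM y)
    rw [← map_smul, ← map_smul, hk, lintegral_map (by fun_prop) (by fun_prop),
      lintegral_map (by fun_prop) (by fun_prop)] at h1
    exact h1
  have h1 := hdct hf hM
    (fun n x => (V n).starProjection (opSqrt R k) + (V n).starProjection x) (fun n => by fun_prop)
    (fun x => opSqrt R k + x) (fun x => (hlim _).add (hlim x))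
  have h2 := hdct (g := fun x => f x ^ p) ((NNReal.continuous_rpow_const hp0).comp hf)
    (fun x => NNReal.rpow_le_rpow (hM x) hp0)
    (fun n x => (V n).starProjection x) (fun n => by fun_prop) (fun x => x) hlim
  simp_rw [ENNReal.coe_rpow_of_nonneg _ hp0] at h2
  have h3 := ENNReal.Tendsto.const_mul
    (a := ENNReal.ofReal (Real.exp (‖k‖ ^ 2 / (2 * (p - 1)))))
    ((ENNReal.continuous_rpow_const (y := 1 / p)).tendsto _ |>.comp h2)
    (Or.inr ENNReal.ofReal_ne_top)
  exact le_of_tendsto_of_tendsto' h1 h3 hn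

/-- Bounded continuous functions are dense in `L^p (μ + ν)`, so a single approximant is close to `f`
for both the law and its translate. -/
theorem eLpNorm_shift_le
    {μ : Measure H} {a : H} {R : H →L[ℝ] H} {m : Measure H} (hμ : HasLevyTriplet μ a R m)
    (k : H) {p : ℝ} (hp : 1 < p) {f : H → ℝ} (hf : IsBoundedMeasurable f) :
    eLpNorm f 1 (μ.map (opSqrt R k + ·))
      ≤ ENNReal.ofReal (Real.exp (‖k‖ ^ 2 / (2 * (p - 1)))) * eLpNorm f (ENNReal.ofReal p) μ := by
  have := hμ.isProbabilityMeasure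
  set K := ENNReal.ofReal (Real.exp (‖k‖ ^ 2 / (2 * (p - 1))))
  set ν := μ.map (opSqrt R k + ·) with hν
  have : IsProbabilityMeasure ν := Measure.isProbabilityMeasure_map (by fun_prop)
  have hp0 : 0 < p := by linarith
  have hp1 : (1 : ℝ≥0∞) ≤ ENNReal.ofReal p := by
    rw [← ENNReal.ofReal_one]; exact ENNReal.ofReal_le_ofReal hp.le
  have hcont : ∀ g : BoundedContinuousFunction H ℝ,
      eLpNorm g 1 ν ≤ K * eLpNorm g (ENNReal.ofReal p) μ := by
    intro g
    have h := lintegral_shift_le_of_continuous hμ k hp (f := fun x => ‖g x‖₊) (by fun_prop)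
      (M := ‖g‖₊) (fun x => g.norm_coe_le_norm x)
    rw [eLpNorm_one_eq_lintegral_enorm, hν, lintegral_map (by fun_prop) (by fun_prop),
      eLpNorm_eq_lintegral_rpow_enorm_toReal (by simpa using hp0) ENNReal.ofReal_ne_top,
      ENNReal.toReal_ofReal hp0.le]
    exact h
  obtain ⟨hfm, C, hC⟩ := hf
  have hmem : MemLp f (ENNReal.ofReal p) (μ + ν) :=
    MemLp.of_bound hfm.aestronglyMeasurable C (Eventually.of_forall hC)
  have hε : ∀ ε : ℝ≥0∞, 0 < ε →
      eLpNorm f 1 ν ≤ K * (eLpNorm f (ENNReal.ofReal p) μ + ε) + ε := by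
    intro ε hε
    obtain ⟨g, hg, hgc, hgb⟩ : ∃ g : H → ℝ, eLpNorm (f - g) (ENNReal.ofReal p) (μ + ν) ≤ ε ∧
        Continuous g ∧ eLpNorm g 1 ν ≤ K * eLpNorm g (ENNReal.ofReal p) μ := by
      obtain ⟨g, hg, -⟩ :=
        hmem.exists_boundedContinuous_eLpNorm_sub_le ENNReal.ofReal_ne_top hε.ne'
      exact ⟨g, hg, g.continuous, hcont g⟩
    have hgm : AEStronglyMeasurable g μ := hgc.aestronglyMeasurable
    have hgn : AEStronglyMeasurable g ν := hgc.aestronglyMeasurable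
    have h1 : eLpNorm (f - g) 1 ν ≤ ε :=
      (eLpNorm_le_eLpNorm_of_exponent_le hp1 (hfm.aestronglyMeasurable.sub hgn)).trans
        ((eLpNorm_mono_measure _ (Measure.le_add_left le_rfl)).trans hg)
    have h2 : eLpNorm (f - g) (ENNReal.ofReal p) μ ≤ ε :=
      (eLpNorm_mono_measure _ (Measure.le_add_right le_rfl)).trans hg
    have h3 : eLpNorm g (ENNReal.ofReal p) μ ≤ eLpNorm f (ENNReal.ofReal p) μ + ε := by
      calc eLpNorm g (ENNReal.ofReal p) μ = eLpNorm (f - (f - g)) (ENNReal.ofReal p) μ := by simp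
        _ ≤ eLpNorm f (ENNReal.ofReal p) μ + eLpNorm (f - g) (ENNReal.ofReal p) μ :=
          eLpNorm_sub_le hfm.aestronglyMeasurable (hfm.aestronglyMeasurable.sub hgm) hp1
        _ ≤ _ := by gcongr
    calc eLpNorm f 1 ν = eLpNorm (g + (f - g)) 1 ν := by simp
      _ ≤ eLpNorm g 1 ν + eLpNorm (f - g) 1 ν :=
        eLpNorm_add_le hgn (hfm.aestronglyMeasurable.sub hgn) le_rfl
      _ ≤ K * eLpNorm g (ENNReal.ofReal p) μ + ε := add_le_add hgb h1
      _ ≤ _ := by gcongr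
  have hlim : Tendsto (fun ε : ℝ≥0∞ => K * (eLpNorm f (ENNReal.ofReal p) μ + ε) + ε) (𝓝[>] 0)
      (𝓝 (K * (eLpNorm f (ENNReal.ofReal p) μ + 0) + 0)) := by
    refine Tendsto.mono_left ?_ nhdsWithin_le_nhds
    exact (ENNReal.Tendsto.const_mul (tendsto_const_nhds.add tendsto_id)
      (Or.inr ENNReal.ofReal_ne_top)).add tendsto_id
  rw [add_zero, add_zero] at hlim
  exact ge_of_tendsto hlim (eventually_nhdsWithin_of_forall hε)

/-- Shifts of a law with Lévy triplet `(a, R, m)` along the range of `R ^ (1/2)`. -/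
theorem integral_shift_rpow_le
    {μ : Measure H} {a : H} {R : H →L[ℝ] H} {m : Measure H} (hμ : HasLevyTriplet μ a R m)
    (k : H) {p : ℝ} (hp : 1 < p) {f : H → ℝ} (hf : IsBoundedMeasurable f) (hf0 : ∀ x, 0 ≤ f x) :
    (∫ x, f (opSqrt R k + x) ∂μ) ^ p
      ≤ Real.exp (p * ‖k‖ ^ 2 / (2 * (p - 1))) * ∫ x, f x ^ p ∂μ := by
  have := hμ.isProbabilityMeasure
  have hp0 : 0 < p := by linarith
  have h := eLpNorm_shift_le hμ k hp hf
  obtain ⟨hfm, C, hC⟩ := hf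
  have hA : 0 ≤ ∫ x, f (opSqrt R k + x) ∂μ := integral_nonneg fun x => hf0 _
  have hB : 0 ≤ ∫ x, f x ^ p ∂μ := integral_nonneg fun x => Real.rpow_nonneg (hf0 x) _
  have hC' : ∀ x, f x ≤ C := fun x => (le_abs_self _).trans (hC x)
  have hint : Integrable (fun x => f (opSqrt R k + x)) μ :=
    Integrable.of_bound (hfm.comp (by fun_prop)).aestronglyMeasurable C
      (Eventually.of_forall fun x => hC _)
  have hint' : Integrable (fun x => f x ^ p) μ := by
    refine Integrable.of_bound (hfm.pow_const p).aestronglyMeasurable (C ^ p)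
      (Eventually.of_forall fun x => ?_)
    rw [Real.norm_of_nonneg (Real.rpow_nonneg (hf0 x) _)]
    exact Real.rpow_le_rpow (hf0 x) (hC' x) hp0.le
  rw [eLpNorm_one_eq_lintegral_enorm, lintegral_map (by fun_prop) (by fun_prop),
    eLpNorm_eq_lintegral_rpow_enorm_toReal (by simpa using hp0) ENNReal.ofReal_ne_top,
    ENNReal.toReal_ofReal hp0.le] at h
  have e1 : ∫⁻ x, ‖f (opSqrt R k + x)‖ₑ ∂μ = ENNReal.ofReal (∫ x, f (opSqrt R k + x) ∂μ) := by
    rw [ofReal_integral_eq_lintegral_ofReal hint (Eventually.of_forall fun x => hf0 _)]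
    exact lintegral_congr fun x => Real.enorm_of_nonneg (hf0 _)
  have e2 : ∫⁻ x, ‖f x‖ₑ ^ p ∂μ = ENNReal.ofReal (∫ x, f x ^ p ∂μ) := by
    rw [ofReal_integral_eq_lintegral_ofReal hint'
      (Eventually.of_forall fun x => Real.rpow_nonneg (hf0 x) _)]
    refine lintegral_congr fun x => ?_
    rw [Real.enorm_of_nonneg (hf0 _), ENNReal.ofReal_rpow_of_nonneg (hf0 x) hp0.le]
  rw [e1, e2, ENNReal.ofReal_rpow_of_nonneg hB (by positivity),
    ← ENNReal.ofReal_mul (Real.exp_pos _).le, ENNReal.ofReal_le_ofReal_iff (by positivity)] at h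
  calc (∫ x, f (opSqrt R k + x) ∂μ) ^ p
      ≤ (Real.exp (‖k‖ ^ 2 / (2 * (p - 1))) * (∫ x, f x ^ p ∂μ) ^ (1 / p)) ^ p :=
        Real.rpow_le_rpow hA h hp0.le
    _ = _ := by
      rw [Real.mul_rpow (Real.exp_pos _).le (by positivity), ← Real.exp_mul, ← Real.rpow_mul hB,
        one_div, inv_mul_cancel₀ hp0.ne', Real.rpow_one]
      congr 2
      ring

end Shift


/-! ### Harnack, log-Harnack and strong Feller. -/

section Harnack

open ProbabilityTheory Filter
open scoped NNReal Topology

variable {H : Type*} [NormedAddCommGroup H] [InnerProductSpace ℝ H] [MeasurableSpace H]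
  [BorelSpace H] [SecondCountableTopology H]
  {U : ℝ → ℝ → H →L[ℝ] H} {μ : ℝ → ℝ → Measure H} {s t : ℝ}

theorem IsBoundedMeasurable.integrable_shift {f : H → ℝ} (hf : IsBoundedMeasurable f)
    (ν : Measure H) [IsFiniteMeasure ν] (z : H) : Integrable (fun y => f (z + y)) ν := by
  obtain ⟨hfm, C, hC⟩ := hf
  exact Integrable.of_bound (hfm.comp (by fun_prop)).aestronglyMeasurable C
    (Eventually.of_forall fun x => hC _)

theorem logHarnackInequality_of_harnackInequality [IsProbabilityMeasure (μ t s)] {C : ℝ}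
    (h : ∀ α : ℝ, 1 < α → HarnackInequality (mehlerOp U μ s t) C α) :
    LogHarnackInequality (mehlerOp U μ s t) C := by
  intro f hf hf1 x y
  have hint := hf.integrable_shift (μ t s) (U t s y)
  obtain ⟨hfm, M, hM⟩ := hf
  have hfM : ∀ z, f z ≤ M := fun z => (le_abs_self _).trans (hM z)
  have hlog : IsBoundedMeasurable fun z => Real.log (f z) := by
    refine ⟨hfm.log, M, fun z => ?_⟩
    rw [abs_of_nonneg (Real.log_nonneg (hf1 z).le)]
    exact (Real.log_le_self (by linarith [hf1 z])).trans (hfM z)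
  set c := mehlerOp U μ s t (fun z => Real.log (f z)) x with hc
  have hc0 : 0 ≤ c := integral_nonneg fun z => Real.log_nonneg (hf1 _).le
  have hPf : 1 ≤ mehlerOp U μ s t f y := by
    calc (1 : ℝ) = ∫ _, (1 : ℝ) ∂(μ t s) := by simp
      _ ≤ _ := integral_mono (integrable_const _) hint fun z => (hf1 _).le
  -- Harnack for `f ^ (1/α)`, combined with `f ^ (1/α) ≥ 1 + log f / α`; letting `α → ∞` turns the
  -- left side into `c`.
  have key : ∀ α : ℝ, 1 < α → α * Real.log (1 + c / α)
      ≤ (C * ‖x - y‖) ^ 2 / 2 * (1 + (α - 1)⁻¹) + Real.log (mehlerOp U μ s t f y) := by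
    intro α hα
    have hα0 : 0 < α := by linarith
    have hα1 : 0 < α - 1 := by linarith
    have hg : IsBoundedMeasurable fun z => f z ^ α⁻¹ := by
      refine ⟨hfm.pow_const _, M ^ α⁻¹, fun z => ?_⟩
      have h0 : 0 ≤ f z := by linarith [hf1 z]
      rw [abs_of_nonneg (Real.rpow_nonneg h0 _)]
      exact Real.rpow_le_rpow h0 (hfM z) (by positivity)
    have h1 := h α hα _ hg (fun z => Real.rpow_nonneg (by linarith [hf1 z]) _) x y
    have h2 : (fun z => (f z ^ α⁻¹) ^ α) = f := by
      funext z
      rw [← Real.rpow_mul (by linarith [hf1 z]), inv_mul_cancel₀ hα0.ne', Real.rpow_one]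
    rw [h2] at h1
    have h3 : 1 + c / α ≤ mehlerOp U μ s t (fun z => f z ^ α⁻¹) x := by
      have hl := hlog.integrable_shift (μ t s) (U t s x)
      calc 1 + c / α = ∫ w, (1 + Real.log (f (U t s x + w)) / α) ∂(μ t s) := by
            rw [integral_add (integrable_const _) (hl.div_const _), integral_div, hc, mehlerOp]
            simp
        _ ≤ _ := by
            refine integral_mono ((integrable_const _).add (hl.div_const _))
              (hg.integrable_shift (μ t s) _) fun w => ?_
            have hp : 0 < f (U t s x + w) := by linarith [hf1 (U t s x + w)]
            change _ ≤ f (U t s x + w) ^ α⁻¹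
            rw [Real.rpow_def_of_pos hp, add_comm, ← div_eq_mul_inv]
            exact Real.add_one_le_exp _
    have h4 : 0 < 1 + c / α := by positivity
    have h5 : (1 + c / α) ^ α
        ≤ Real.exp (α * (C * ‖x - y‖) ^ 2 / (2 * (α - 1))) * mehlerOp U μ s t f y :=
      (Real.rpow_le_rpow h4.le h3 hα0.le).trans h1
    have h6 := Real.log_le_log (by positivity) h5
    rw [Real.log_rpow h4, Real.log_mul (Real.exp_pos _).ne' (by linarith), Real.log_exp] at h6
    refine h6.trans_eq ?_
    congr 1
    field_simp
    ring
  have hlim1 : Tendsto (fun α : ℝ => α * Real.log (1 + c / α)) atTop (𝓝 c) :=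
    Real.tendsto_mul_log_one_add_div_atTop c
  have hlim2 : Tendsto (fun α : ℝ => (C * ‖x - y‖) ^ 2 / 2 * (1 + (α - 1)⁻¹)
      + Real.log (mehlerOp U μ s t f y)) atTop
      (𝓝 ((C * ‖x - y‖) ^ 2 / 2 * (1 + 0) + Real.log (mehlerOp U μ s t f y))) := by
    have h7 : Tendsto (fun α : ℝ => (α - 1)⁻¹) atTop (𝓝 0) :=
      tendsto_inv_atTop_zero.comp (tendsto_atTop_add_const_right _ (-1) tendsto_id)
    exact ((h7.const_add 1).const_mul _).add_const _
  have h8 := le_of_tendsto_of_tendsto hlim1 hlim2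
    ((eventually_gt_atTop 1).mono fun α hα => key α hα)
  refine h8.trans_eq ?_
  ring

/-- Test with `1 + d (f + M + 1)`, where `d = |x - y|`. Since `u - u² / 2 ≤ log (1 + u) ≤ u` for `u
≥ 0`, the inequality linearizes with errors of order `d²`; dividing by `d` gives a Lipschitz bound.
-/
theorem strongFeller_of_logHarnackInequality [IsProbabilityMeasure (μ t s)] {C : ℝ}
    (h : LogHarnackInequality (mehlerOp U μ s t) C) : StrongFeller (mehlerOp U μ s t) := by
  intro f hf
  have hfint := hf.integrable_shift (μ t s)
  obtain ⟨hfm, M, hM⟩ := hf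
  have hM0 : 0 ≤ M := (abs_nonneg _).trans (hM 0)
  refine ⟨?_, M, fun x => ?_⟩
  swap
  · have := norm_integral_le_of_norm_le_const (μ := μ t s) (f := fun y => f (U t s x + y)) (C := M)
      (Eventually.of_forall fun y => hM _)
    simpa [mehlerOp] using this
  set B := 2 * M + 1 with hB
  let K : ℝ≥0 := ⟨(B ^ 2 + C ^ 2) / 2, by positivity⟩
  refine (LipschitzWith.of_le_add_mul K fun x y => ?_).continuous
  rcases eq_or_ne x y with rfl | hxy
  · simp
  set d := ‖x - y‖ with hd
  have hd0 : 0 < d := norm_pos_iff.2 (sub_ne_zero.2 hxy)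
  have hg : ∀ z, 1 ≤ f z + M + 1 ∧ f z + M + 1 ≤ B := fun z => by
    have := abs_le.1 (hM z)
    constructor <;> linarith
  have hF : IsBoundedMeasurable fun z => 1 + d * (f z + M + 1) := by
    refine ⟨by fun_prop, 1 + d * B, fun z => ?_⟩
    obtain ⟨h1, h2⟩ := hg z
    have h3 := mul_le_mul_of_nonneg_left h2 hd0.le
    have h4 := mul_nonneg hd0.le (zero_le_one.trans h1)
    rw [abs_of_nonneg (by linarith)]
    linarith
  have hF1 : ∀ z, 1 < 1 + d * (f z + M + 1) := fun z => by
    have := mul_pos hd0 (zero_lt_one.trans_le (hg z).1)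
    linarith
  have hlog : IsBoundedMeasurable fun z => Real.log (1 + d * (f z + M + 1)) := by
    obtain ⟨hFm, N, hN⟩ := hF
    refine ⟨hFm.log, N, fun z => ?_⟩
    rw [abs_of_nonneg (Real.log_nonneg (hF1 z).le)]
    exact (Real.log_le_self (by linarith [hF1 z])).trans ((le_abs_self _).trans (hN z))
  have h1 := h _ hF hF1 x y
  have haff : ∀ (z : H) (b : ℝ), ∫ w, (b + d * (f (U t s z + w) + M + 1)) ∂(μ t s)
      = b + d * (mehlerOp U μ s t f z + M + 1) := by
    intro z b
    have i1 : Integrable (fun w => f (U t s z + w) + M) (μ t s) :=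
      (hfint _).add (integrable_const _)
    have i2 : Integrable (fun w => f (U t s z + w) + M + 1) (μ t s) := i1.add (integrable_const _)
    rw [integral_add (integrable_const _) (i2.const_mul _), integral_const_mul,
      integral_add i1 (integrable_const _), integral_add (hfint _) (integrable_const _)]
    simp [mehlerOp]
  have hlow : -(d ^ 2 * B ^ 2 / 2) + d * (mehlerOp U μ s t f x + M + 1)
      ≤ mehlerOp U μ s t (fun z => Real.log (1 + d * (f z + M + 1))) x := by
    rw [← haff]
    refine integral_mono ?_ (hlog.integrable_shift (μ t s) _) fun w => ?_
    · exact (integrable_const _).add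
        ((((hfint _).add (integrable_const _)).add (integrable_const _)).const_mul _)
    · obtain ⟨hg1, hg2⟩ := hg (U t s x + w)
      set g := f (U t s x + w) + M + 1
      have hu : 0 ≤ d * g := by positivity
      have hl := Real.le_log_one_add_of_nonneg hu
      refine le_trans ?_ hl
      rw [le_div_iff₀ (by positivity)]
      have hgB : (d * g) ^ 2 ≤ d ^ 2 * B ^ 2 := by
        rw [mul_pow]; gcongr
      nlinarith [mul_nonneg hu (sq_nonneg (d * B))]
  have hup : Real.log (mehlerOp U μ s t (fun z => 1 + d * (f z + M + 1)) y)
      ≤ d * (mehlerOp U μ s t f y + M + 1) := by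
    have e : mehlerOp U μ s t (fun z => 1 + d * (f z + M + 1)) y
        = 1 + d * (mehlerOp U μ s t f y + M + 1) := haff y 1
    have hpos : -M ≤ mehlerOp U μ s t f y := by
      calc -M = ∫ _, -M ∂(μ t s) := by simp
        _ ≤ _ := integral_mono (integrable_const _) (hfint _) fun w => (abs_le.1 (hM _)).1
    have hpos' : 0 < 1 + d * (mehlerOp U μ s t f y + M + 1) := by
      have := mul_pos hd0 (show 0 < mehlerOp U μ s t f y + M + 1 by linarith)
      linarith
    rw [e]
    linarith [Real.log_le_sub_one_of_pos hpos']
  have h2 : d * mehlerOp U μ s t f x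
      ≤ d * (mehlerOp U μ s t f y + (B ^ 2 + C ^ 2) / 2 * d) := by
    nlinarith
  have h3 := le_of_mul_le_mul_left h2 hd0
  rw [dist_eq_norm]
  exact h3

variable [CompleteSpace H] {a : H} {R : H →L[ℝ] H} {m : Measure H}

theorem harnackForAll_of_nullControllability (hμ : HasLevyTriplet (μ t s) a R m)
    (h : NullControllability R (U t s)) : HarnackForAll R (U t s) (mehlerOp U μ s t) := by
  refine ⟨gammaNorm_lt_top h, fun α hα f hf hf0 x y => ?_⟩
  have hα1 : 0 < α - 1 := by linarith
  have hF : IsBoundedMeasurable fun w => f (U t s y + w) := by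
    obtain ⟨hfm, C, hC⟩ := hf
    exact ⟨hfm.comp (by fun_prop), C, fun w => hC _⟩
  have h1 := integral_shift_rpow_le hμ (gammaOp h (x - y)) hα hF (fun w => hf0 _)
  have h2 : ∀ w, U t s y + (opSqrt R (gammaOp h (x - y)) + w) = U t s x + w := fun w => by
    rw [opSqrt_gammaOp, map_sub]
    abel
  simp_rw [h2] at h1
  refine h1.trans ?_
  have h3 : 0 ≤ ∫ w, f (U t s y + w) ^ α ∂(μ t s) :=
    integral_nonneg fun w => Real.rpow_nonneg (hf0 _) _
  refine mul_le_mul_of_nonneg_right ?_ h3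
  gcongr
  exact norm_gammaOp_apply_le h _

/-! ### The Gaussian converse: translates outside the range of `R ^ (1/2)`. -/

theorem map_inner_eq_gaussianReal {ν : Measure H} (hν : HasLevyTriplet ν a R 0) (ξ : H) :
    ν.map (fun y => ⟪ξ, y⟫) = gaussianReal ⟪ξ, a⟫ (‖opSqrt R ξ‖₊ ^ 2) := by
  have := hν.isProbabilityMeasure
  have : IsProbabilityMeasure (ν.map (fun y => ⟪ξ, y⟫)) :=
    Measure.isProbabilityMeasure_map (by fun_prop)
  obtain ⟨hS, hSS⟩ := opSqrt_spec hν.isPositiveTraceClass.isPositive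
  refine Measure.ext_of_charFun (funext fun r => ?_)
  have h1 : charFun (ν.map (fun y => ⟪ξ, y⟫)) r = charFun ν (r • ξ) := by
    rw [charFun_apply_real, integral_map (by fun_prop) (by fun_prop), charFun_apply]
    refine integral_congr_ae (Eventually.of_forall fun y => ?_)
    simp [real_inner_smul_right, real_inner_comm]
  have h2 : ⟪ξ, R ξ⟫ = ‖opSqrt R ξ‖ ^ 2 := by
    conv_lhs => rw [← hSS]
    rw [← real_inner_self_eq_norm_sq, hS.inner_left_eq_inner_right]
    rfl
  rw [h1, hν.charFun_eq, charFun_gaussianReal]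
  congr 1
  simp only [levyExponent, integral_zero_measure, map_smul, real_inner_smul_left,
    real_inner_smul_right, h2, real_inner_comm a ξ]
  push_cast
  ring

theorem lintegral_inner_sub_sq {ν : Measure H} (hν : HasLevyTriplet ν a R 0) (ξ : H) :
    ∫⁻ y, ENNReal.ofReal (⟪ξ, y - a⟫ ^ 2) ∂ν = ENNReal.ofReal (‖opSqrt R ξ‖ ^ 2) := by
  have h1 := (memLp_id_gaussianReal (μ := ⟪ξ, a⟫) (v := ‖opSqrt R ξ‖₊ ^ 2) 2).ofReal_variance_eq
  rw [variance_id_gaussianReal, evariance_eq_lintegral_ofReal, ← map_inner_eq_gaussianReal hν,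
    lintegral_map (by fun_prop) (by fun_prop), map_inner_eq_gaussianReal hν] at h1
  simp only [id, integral_id_gaussianReal, ← inner_sub_right] at h1
  rw [← h1]
  simp

/-- A Gaussian law is singular to its translates in directions outside the range of `R ^ (1/2)`,
with a separating set that does not depend on the size of the translation. -/
theorem exists_measurableSet_ae_mem_and_forall_shift_notMem {ν : Measure H}
    (hν : HasLevyTriplet ν a R 0) {h : H} (hh : h ∉ range (opSqrt R)) :
    ∃ A : Set H, MeasurableSet A ∧ (∀ᵐ y ∂ν, y ∈ A) ∧
      ∀ c : ℝ, c ≠ 0 → ∀ y ∈ A, c • h + y ∉ A := by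
  obtain ⟨hS, -⟩ := opSqrt_spec hν.isPositiveTraceClass.isPositive
  -- Otherwise `|⟪h, ξ⟫| ≤ 2 ^ n * ‖S ξ‖` for all `ξ`, which would put `h` in the range.
  have hex : ∀ n : ℕ, ∃ ξ : H, ⟪ξ, h⟫ = 1 ∧ ‖opSqrt R ξ‖ ^ 2 ≤ (1 / 4 : ℝ) ^ n := by
    intro n
    by_contra! hcon
    refine hh (mem_range_of_abs_inner_le hS.isSelfAdjoint (C := 2 ^ n) fun ξ => ?_)
    by_contra! hlt
    have hpos : 0 < |⟪h, ξ⟫| := lt_of_le_of_lt (by positivity) hlt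
    have hne : ⟪h, ξ⟫ ≠ 0 := abs_pos.1 hpos
    have h1 := hcon (⟪h, ξ⟫⁻¹ • ξ) (by
      rw [real_inner_smul_left, real_inner_comm h ξ, inv_mul_cancel₀ hne])
    rw [map_smul, norm_smul, norm_inv, Real.norm_eq_abs, mul_pow, inv_pow,
      lt_inv_mul_iff₀ (by positivity)] at h1
    have h2 : (2 ^ n * ‖opSqrt R ξ‖) ^ 2 < |⟪h, ξ⟫| ^ 2 := by gcongr
    have h3 : ((2 : ℝ) ^ n) ^ 2 * (1 / 4 : ℝ) ^ n = 1 := by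
      rw [← pow_mul, mul_comm n 2, pow_mul, ← mul_pow]
      norm_num
    have h4 : (0 : ℝ) < (1 / 4 : ℝ) ^ n := by positivity
    have h5 := mul_lt_mul_of_pos_right h2 h4
    rw [mul_pow] at h5
    nlinarith
  choose ξ hξ1 hξ2 using hex
  -- The variances of `⟪ξ n, y - a⟫` are summable, so these variables tend to `0` almost surely; a
  -- translation by `c • h` moves each of them by exactly `c`.
  refine ⟨{y | Tendsto (fun n => ⟪ξ n, y - a⟫) atTop (𝓝 0)},
    measurableSet_tendsto _ (fun n => by fun_prop), ?_, fun c hc y hy hcy => ?_⟩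
  · have h1 : ∫⁻ y, ∑' n, ENNReal.ofReal (⟪ξ n, y - a⟫ ^ 2) ∂ν ≠ ∞ := by
      rw [lintegral_tsum fun n => by fun_prop]
      simp_rw [lintegral_inner_sub_sq hν]
      have h2 : Summable fun n => ‖opSqrt R (ξ n)‖ ^ 2 :=
        Summable.of_nonneg_of_le (fun n => by positivity) hξ2
          (summable_geometric_of_lt_one (by norm_num) (by norm_num))
      exact h2.tsum_ofReal_ne_top
    filter_upwards [ae_lt_top' (by fun_prop) h1] with y hy
    have h3 := ENNReal.tendsto_atTop_zero_of_tsum_ne_top hy.ne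
    have h4 := (ENNReal.tendsto_toReal ENNReal.zero_ne_top).comp h3
    have h5 : Tendsto (fun n => ⟪ξ n, y - a⟫ ^ 2) atTop (𝓝 0) := by
      refine h4.congr fun n => ?_
      exact ENNReal.toReal_ofReal (sq_nonneg _)
    have h6 := (Real.continuous_sqrt.tendsto 0).comp h5
    rw [Real.sqrt_zero] at h6
    exact (tendsto_zero_iff_abs_tendsto_zero _).2 (h6.congr fun n => Real.sqrt_sq_eq_abs _)
  · refine hc ?_
    have h1 := Tendsto.sub hcy hy
    rw [sub_zero] at h1
    have h2 : Tendsto (fun _ : ℕ => c) atTop (𝓝 0) := by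
      refine h1.congr fun n => ?_
      rw [← inner_sub_right, show c • h + y - a - (y - a) = c • h by abel, real_inner_smul_right,
        hξ1, mul_one]
    exact tendsto_nhds_unique tendsto_const_nhds h2

theorem nullControllability_of_strongFeller (hμ : HasLevyTriplet (μ t s) a R 0)
    (h : StrongFeller (mehlerOp U μ s t)) : NullControllability R (U t s) := by
  have := hμ.isProbabilityMeasure
  rintro _ ⟨x, rfl⟩
  by_contra hx
  obtain ⟨A, hA, hAe, hAs⟩ := exists_measurableSet_ae_mem_and_forall_shift_notMem hμ hx
  have hcont := (h (A.indicator fun _ => 1) ⟨measurable_const.indicator hA, 1, fun y => by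
    by_cases hy : y ∈ A <;> simp [hy]⟩).1
  have hφ : Continuous fun c : ℝ => mehlerOp U μ s t (A.indicator fun _ => 1) (c • x) :=
    hcont.comp (by fun_prop)
  have h0 : (fun c : ℝ => mehlerOp U μ s t (A.indicator fun _ => 1) (c • x)) = fun _ => 0 := by
    -- Vanishing for `c ≠ 0` forces vanishing at `0` by continuity, against the value `1` found
    -- below.
    refine Continuous.ext_on (dense_compl_singleton (0 : ℝ)) hφ continuous_const fun c hc => ?_
    refine integral_eq_zero_of_ae ?_
    filter_upwards [hAe] with y hy
    rw [map_smul]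
    exact indicator_of_notMem (hAs c hc y hy) _
  have h1 : mehlerOp U μ s t (A.indicator fun _ => 1) ((0 : ℝ) • x) = 1 := by
    have h2 : ∀ᵐ y ∂(μ t s), A.indicator (fun _ => (1 : ℝ)) (U t s ((0 : ℝ) • x) + y) = 1 := by
      filter_upwards [hAe] with y hy
      simp [hy]
    rw [mehlerOp, integral_congr_ae h2]
    simp
  exact one_ne_zero (h1.symm.trans (congrFun h0 0))

end Harnack

end MehlerSemigroup

theorem mainTheorem3 {H : Type*} [NormedAddCommGroup H] [InnerProductSpace ℝ H]
    [CompleteSpace H] [SecondCountableTopology H] [MeasurableSpace H] [BorelSpace H]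
    (U : ℝ → ℝ → H →L[ℝ] H) (μ : ℝ → ℝ → Measure H)
    (a : ℝ → ℝ → H) (R : ℝ → ℝ → H →L[ℝ] H) (m : ℝ → ℝ → Measure H)
    (hU : MehlerSemigroup.IsEvolutionFamily U)
    (hμ : ∀ s t : ℝ, s ≤ t → MehlerSemigroup.HasLevyTriplet (μ t s) (a t s) (R t s) (m t s))
    (hskew : MehlerSemigroup.SkewConvolution U μ)
    (s t : ℝ) (hst : s ≤ t) :
    (MehlerSemigroup.NullControllability (R t s) (U t s) →
      MehlerSemigroup.HarnackForAll (R t s) (U t s) (MehlerSemigroup.mehlerOp U μ s t)) ∧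
    (MehlerSemigroup.HarnackForAll (R t s) (U t s) (MehlerSemigroup.mehlerOp U μ s t) →
      MehlerSemigroup.HarnackForSome (R t s) (U t s) (MehlerSemigroup.mehlerOp U μ s t)) ∧
    (MehlerSemigroup.HarnackForSome (R t s) (U t s) (MehlerSemigroup.mehlerOp U μ s t) →
      MehlerSemigroup.LogHarnack (R t s) (U t s) (MehlerSemigroup.mehlerOp U μ s t)) ∧
    (MehlerSemigroup.LogHarnack (R t s) (U t s) (MehlerSemigroup.mehlerOp U μ s t) →
      MehlerSemigroup.StrongFeller (MehlerSemigroup.mehlerOp U μ s t)) ∧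
    (m t s = 0 →
      List.TFAE
        [MehlerSemigroup.NullControllability (R t s) (U t s),
         MehlerSemigroup.HarnackForAll (R t s) (U t s) (MehlerSemigroup.mehlerOp U μ s t),
         MehlerSemigroup.HarnackForSome (R t s) (U t s) (MehlerSemigroup.mehlerOp U μ s t),
         MehlerSemigroup.LogHarnack (R t s) (U t s) (MehlerSemigroup.mehlerOp U μ s t),
         MehlerSemigroup.StrongFeller (MehlerSemigroup.mehlerOp U μ s t)]) := by
  have hts := hμ s t hst
  have := hts.isProbabilityMeasure
  have h12 := MehlerSemigroup.harnackForAll_of_nullControllability (U := U) hts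
  have h23 : MehlerSemigroup.HarnackForAll (R t s) (U t s) (MehlerSemigroup.mehlerOp U μ s t) →
      MehlerSemigroup.HarnackForSome (R t s) (U t s) (MehlerSemigroup.mehlerOp U μ s t) :=
    fun h => ⟨h.1, 2, one_lt_two, h.2 2 one_lt_two⟩
  -- The given exponent is not exploited: finiteness of `‖Γ‖` already yields null-controllability,
  -- hence Harnack for all exponents.
  have h34 : MehlerSemigroup.HarnackForSome (R t s) (U t s) (MehlerSemigroup.mehlerOp U μ s t) →
      MehlerSemigroup.LogHarnack (R t s) (U t s) (MehlerSemigroup.mehlerOp U μ s t) :=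
    fun h => ⟨h.1, MehlerSemigroup.logHarnackInequality_of_harnackInequality
      (h12 (MehlerSemigroup.nullControllability_of_gammaNorm_lt_top h.1)).2⟩
  have h45 : MehlerSemigroup.LogHarnack (R t s) (U t s) (MehlerSemigroup.mehlerOp U μ s t) →
      MehlerSemigroup.StrongFeller (MehlerSemigroup.mehlerOp U μ s t) :=
    fun h => MehlerSemigroup.strongFeller_of_logHarnackInequality h.2
  refine ⟨h12, h23, h34, h45, fun hm => ?_⟩
  have h51 : MehlerSemigroup.StrongFeller (MehlerSemigroup.mehlerOp U μ s t) →
      MehlerSemigroup.NullControllability (R t s) (U t s) := by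
    rw [hm] at hts
    exact MehlerSemigroup.nullControllability_of_strongFeller hts
  tfae_have 1 → 2 := h12
  tfae_have 2 → 3 := h23
  tfae_have 3 → 4 := h34
  tfae_have 4 → 5 := h45
  tfae_have 5 → 1 := h51
  tfae_finish
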